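/- Let $\hat\beta\sim N(\beta,\Sigma)$ in $\mathbb{R}^n$, where the mean $\beta\in\mathbb{R}^n$ is unknown and the positive definite covariance matrix $\Sigma$ is known. Let $\beta_{post}$ and $\hat\beta_{post}$ denote a fixed selection of the coordinates of $\beta$ and $\hat\beta$, let $l\neq 0$ be a fixed coefficient vector, and let $l_{post}\in\mathbb{R}^n$ be the vector with $l'b_{post}=l_{post}'b$ for all $b\in\mathbb{R}^n$. Let $B_{post}\subseteq\mathbb{R}^n$ be a Borel set of positive Lebesgue measure and let $\alpha\in(0,1)$. An estimator $\mu_\alpha=\mu_\alpha(\hat\beta)$, with $\mu_\alpha:\mathbb{R}^n\to\mathbb{R}$ measurable, is called $\alpha$-quantile conditionally unbiased for $l'\beta_{post}$ given $\hat\beta\in B_{post}$ if $$P_\beta\bigl(l'\beta_{post}\le \mu_\alpha \mid \hat\beta\in B_{post}\bigr)=\alpha\qquad\text{for all }\beta\in\mathbb{R}^n .$$ Put $\sigma_{post}^2=l_{post}'\Sigma l_{post}$, $\gamma=\Sigma l_{post}/\sigma_{post}^2$, $\hat r=\hat\beta-\gamma\, l'\hat\beta_{post}$ and $\hat T_{post}=\{z\in\mathbb{R}:\hat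 r+\gamma z\in B_{post}\}$. With $\phi$ the standard normal density, let $$F_{TN}(z;\mu,\sigma^2,T)=\frac{\int_{(-\infty,z]\cap T}\phi((t-\mu)/\sigma)\,dt}{\int_{T}\phi((t-\mu)/\sigma)\,dt}$$ be the distribution function of the $N(\mu,\sigma^2)$ distribution truncated to $T$. Let $\mu^*_\alpha$ be the solution $m$ of $$F_{TN}(l'\hat\beta_{post};m,\sigma_{post}^2,\hat T_{post})=1-\alpha$$ (and $\mu_\alpha^*=0$ if there is no solution). Then: (i) for every $\beta$, conditionally on $\hat\beta\in B_{post}$ this equation has almost surely exactly one solution $m\in\mathbb{R}$; (ii) $\mu^*_\alpha$ is $\alpha$-quantile conditionally unbiased for $l'\beta_{post}$ given $\hat\beta\in B_{post}$; (iii) for every $\alpha$-quantile conditionally unbiased estimator $\mu_\alpha$, every $\beta\in\mathbb{R}^n$, and every real-valued loss function $L$ such that $d\mapsto L(d,l'\beta_{post})$ is quasiconvex on $\mathbb{R}$ and attains its minimum at $d=l'\beta_{post}$, $$E_\beta\bigl[L(\mu^*_\alpha,l'\beta_{post})\mid\hat\beta\in B_{post}\bigr]\le E_\beta\bigl[L(\mu_\alpha,l'\beta_{post})\mid\hat\beta\in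 B_{post}\bigr],$$ where the expectations, of functions that are bounded below, take values in $(-\infty,+\infty]$. -/

import Mathlib

open MeasureTheory ProbabilityTheory Matrix
open scoped ENNReal

namespace PostSel

noncomputable section

/-- The CDF at `z` of the `N(m, σ²)` distribution truncated to `T`:
`∫_{t ≤ z, t ∈ T} φ((t - m)/σ) dt / ∫_{t ∈ T} φ((t - m)/σ) dt`,
where `φ` is the standard normal density. -/
def truncCDF (z m σ : ℝ) (T : Set ℝ) : ℝ :=
  (∫ t in Set.Iic z ∩ T, gaussianPDFReal 0 1 ((t - m) / σ)) /
    (∫ t in T, gaussianPDFReal 0 1 ((t - m) / σ))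

/-- Expectation of `f` under `P`, as an extended real number: `E[f⁺] - E[f⁻]`. For `f` bounded
below this is an element of `(-∞, +∞]`. -/
def extExpect {Ω : Type*} [MeasurableSpace Ω] (P : Measure Ω) (f : Ω → ℝ) : EReal :=
  ((∫⁻ x, ENNReal.ofReal (f x) ∂P : ℝ≥0∞) : EReal) -
    ((∫⁻ x, ENNReal.ofReal (-f x) ∂P : ℝ≥0∞) : EReal)

section Model

variable {ι κ : Type*} [Fintype ι] [Fintype κ]

/-- `l' b_post`, where `b_post` is the subvector of `b` with coordinates selected by `post`. -/
def postLin (post : κ ↪ ι) (l : κ → ℝ) (b : EuclideanSpace ℝ ι) : ℝ :=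
  ∑ k, l k * b (post k)

/-- The vector `l_post` with `l' b_post = l_post' b`: the coefficients `l` placed at the selected
coordinates, and zero at all others. -/
def lPost (post : κ ↪ ι) (l : κ → ℝ) : ι → ℝ :=
  Function.extend post l 0

/-- The variance `σ²_post = l_post' S l_post` of `l' β̂_post`. -/
def postVar (S : Matrix ι ι ℝ) (post : κ ↪ ι) (l : κ → ℝ) : ℝ :=
  lPost post l ⬝ᵥ (S *ᵥ lPost post l)

/-- The regression coefficient `γ = S l_post / σ²_post` of `β̂` on `l' β̂_post`. -/
def postCoef (S : Matrix ι ι ℝ) (post : κ ↪ ι) (l : κ → ℝ) : EuclideanSpace ℝ ι :=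
  WithLp.toLp 2 ((postVar S post l)⁻¹ • (S *ᵥ lPost post l))

/-- The residual `r = b - γ l' b_post`. -/
def postResid (S : Matrix ι ι ℝ) (post : κ ↪ ι) (l : κ → ℝ) (b : EuclideanSpace ℝ ι) :
    EuclideanSpace ℝ ι :=
  b - postLin post l b • postCoef S post l

/-- The truncation set `{z : r + γ z ∈ B}` at the residual `r` of `b`. -/
def postTrunc (S : Matrix ι ι ℝ) (post : κ ↪ ι) (l : κ → ℝ) (B : Set (EuclideanSpace ℝ ι))
    (b : EuclideanSpace ℝ ι) : Set ℝ :=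
  {z | postResid S post l b + z • postCoef S post l ∈ B}

/-- The equation that defines the estimator at the realization `b` of `β̂`: the candidate value
`m` solves `F_TN(l' b_post; m, σ²_post, T_post(r)) = 1 - α`. -/
def SolvesAt (S : Matrix ι ι ℝ) (post : κ ↪ ι) (l : κ → ℝ) (B : Set (EuclideanSpace ℝ ι))
    (α : ℝ) (b : EuclideanSpace ℝ ι) (m : ℝ) : Prop :=
  truncCDF (postLin post l b) m (Real.sqrt (postVar S post l)) (postTrunc S post l B b) = 1 - α

open Classical in
/-- The estimator `μ*_α`: the solution of its defining equation, and `0` at realizations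
where there is none (a null subset of `B`, and possibly points outside `B`). -/
def muStar (S : Matrix ι ι ℝ) (post : κ ↪ ι) (l : κ → ℝ) (B : Set (EuclideanSpace ℝ ι))
    (α : ℝ) (b : EuclideanSpace ℝ ι) : ℝ :=
  if h : ∃ m, SolvesAt S post l B α b m then h.choose else 0

/-- The conditional law of `β̂ ~ N(β, S)` given `β̂ ∈ B`. -/
def condLaw [DecidableEq ι] (S : Matrix ι ι ℝ) (B : Set (EuclideanSpace ℝ ι))
    (β : EuclideanSpace ℝ ι) : Measure (EuclideanSpace ℝ ι) :=
  cond (multivariateGaussian β S) B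

/-- `q` is an `α`-quantile conditionally unbiased estimator of `l' β_post` given `β̂ ∈ B`:
`P_β(l' β_post ≤ q(β̂) | β̂ ∈ B) = α` for every mean `β`. -/
structure IsQuantileCondUnbiased [DecidableEq ι] (S : Matrix ι ι ℝ) (post : κ ↪ ι) (l : κ → ℝ)
    (B : Set (EuclideanSpace ℝ ι)) (α : ℝ) (q : EuclideanSpace ℝ ι → ℝ) : Prop where
  measurable : Measurable q
  prob_eq : ∀ β : EuclideanSpace ℝ ι, (condLaw S B β).real {b | postLin post l β ≤ q b} = α

end Model

end

end PostSel

/-! Write `u` for `postVec`, so that the target is `⟪u, β⟫`, and `c` for `postCoef`. The residual `r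
= b - ⟪u, b⟫ • c` is independent of `z = ⟪u, b⟫`, which is normal with mean `⟪u, β⟫`. Conditionally
on `r` and on `B`, `z` is therefore a normal variable truncated to the section of `B` over `r`, and
its law depends on `β` only through the target (`IsGaussianLocation.eq_map_prod`).

Fix `m` and regard `{m ≤ q}` as a test. Unbiasedness gives it conditional probability `α` at every
`β` with `⟪u, β⟫ = m`. On this hyperplane the residual is complete, so the test has probability `α`
on almost every fibre under mean `m` (`IsGaussianLocation.ae_measure_section_eq`). The event `{m ≤
muStar}` also has size `α` on the fibre, because it says that the distribution function at `z` is at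
least `1 - α`; moreover it is an upper part of the truncation set. Normal laws have monotone
likelihood ratio in the mean, so by Neyman–Pearson it is the likelier event under means above `m`
and the less likely one under means below `m`. Integrating over `r`, `muStar` is more concentrated
around the target than `q`, in terms of half-lines. Sublevel sets of the loss are empty or intervals
around the target, so the layer-cake formula compares the risks.

Existence and uniqueness of the solution: comparing the truncated distribution function with `1 - α`
amounts to comparing `α` times the mass below `z` with `1 - α` times the mass above it. Divided by a
common exponential factor, the first is strictly decreasing in `m` and the second strictly
increasing, and both are unbounded, so they cross once (`exists_mgf_crossing`). This needs mass on
both sides of `z`, which holds almost surely because normal laws have no atoms. -/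

namespace PostSel

open scoped RealInnerProductSpace

/-! ### Residuals along a linear statistic -/

section Resid

variable {E : Type*} [NormedAddCommGroup E] [InnerProductSpace ℝ E]

/-- The residual of `b` after removing the direction `c` along the linear statistic `⟪u, ·⟫`. -/
def resid (u c b : E) : E := b - ⟪u, b⟫ • c

theorem inner_resid (t u c b : E) : ⟪t, resid u c b⟫ = ⟪t - ⟪t, c⟫ • u, b⟫ := by
  simp [resid, inner_sub_left, inner_sub_right, inner_smul_left, inner_smul_right]
  ring

theorem resid_add_smul {u c r : E} (huc : ⟪u, c⟫ = 1) (hr : ⟪u, r⟫ = 0) (z : ℝ) :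
    resid u c (r + z • c) = r := by
  simp [resid, inner_add_right, inner_smul_right, huc, hr]

variable [SecondCountableTopology E] [MeasurableSpace E] [BorelSpace E]

theorem measurable_resid (u c : E) : Measurable (resid u c) := by
  unfold resid; fun_prop

theorem ae_inner_eq_zero_map_resid {u c : E} (huc : ⟪u, c⟫ = 1)
    (μ : Measure E) : ∀ᵐ r ∂(μ.map (resid u c)), ⟪u, r⟫ = 0 := by
  have hset : MeasurableSet {r : E | ⟪u, r⟫ = 0} :=
    measurableSet_eq_fun (by fun_prop) (by fun_prop)
  rw [ae_map_iff (measurable_resid u c).aemeasurable hset]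
  refine Filter.Eventually.of_forall fun b => ?_
  rw [inner_resid, huc]; simp

theorem measurable_gaussianReal_section (c : E) (m : ℝ) (v : NNReal) {M : Set E}
    (hM : MeasurableSet M) : Measurable fun r : E => gaussianReal m v {z | r + z • c ∈ M} :=
  measurable_measure_prodMk_left (ν := gaussianReal m v)
    (s := (fun p : E × ℝ => p.1 + p.2 • c) ⁻¹' M)
    ((by fun_prop : Measurable fun p : E × ℝ => p.1 + p.2 • c) hM)

end Resid

/-! ### Gaussian location families: tilting, independence and completeness, by Laplace transforms -/

section GaussianLocation

variable {E : Type*} [NormedAddCommGroup E] [InnerProductSpace ℝ E] [CompleteSpace E]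
  [SecondCountableTopology E] [MeasurableSpace E] [BorelSpace E]

/-- Two finite measures with the same, everywhere finite, Laplace transform agree. -/
theorem ext_of_integral_exp_inner {μ ν : Measure E} [IsFiniteMeasure μ] [IsFiniteMeasure ν]
    (hμ : ∀ t : E, Integrable (fun x => Real.exp ⟪t, x⟫) μ)
    (h : ∀ t : E, ∫ x, Real.exp ⟪t, x⟫ ∂μ = ∫ x, Real.exp ⟪t, x⟫ ∂ν) : μ = ν := by
  apply Measure.ext_of_charFun
  ext t
  have hmass : μ.real Set.univ = ν.real Set.univ := by simpa using h 0
  have h0 : μ = 0 ↔ ν = 0 := by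
    rw [← Measure.measure_univ_eq_zero, ← Measure.measure_univ_eq_zero,
      ← measureReal_eq_zero_iff, ← measureReal_eq_zero_iff, hmass]
  have hmgf : mgf (fun x => ⟪t, x⟫) μ = mgf (fun x => ⟪t, x⟫) ν := by
    ext s
    simpa [mgf, inner_smul_left] using h (s • t)
  have huniv : integrableExpSet (fun x => ⟪t, x⟫) μ = Set.univ := by
    refine Set.eq_univ_of_forall fun s => ?_
    simpa [integrableExpSet, inner_smul_left] using hμ (s • t)
  -- The Laplace transform is finite everywhere, so its complex extension is entire, and equality on
  -- the real line propagates to `I`, where it is the characteristic function.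
  have key := eqOn_complexMGF_of_mgf' hmgf h0 (x := Complex.I) (by simp [huniv])
  have hc : ∀ ρ : Measure E, charFun ρ t = complexMGF (fun x => ⟪t, x⟫) ρ Complex.I := by
    intro ρ
    simp only [charFun, complexMGF]
    refine integral_congr_ae (Filter.Eventually.of_forall fun x => ?_)
    simp only [real_inner_comm, mul_comm]
  rw [hc, hc, key]

/-- `P` is the location family of Gaussian measures with covariance operator `A`, as determined by
Laplace transforms. -/
structure IsGaussianLocation (A : E →L[ℝ] E) (P : E → Measure E) : Prop where
  prob : ∀ β, IsProbabilityMeasure (P β)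
  symm : ∀ x y : E, ⟪x, A y⟫ = ⟪A x, y⟫
  integrable_exp : ∀ β t : E, Integrable (fun x => Real.exp ⟪t, x⟫) (P β)
  integral_exp : ∀ β t : E, ∫ x, Real.exp ⟪t, x⟫ ∂(P β) = Real.exp (⟪t, β⟫ + ⟪t, A t⟫ / 2)

variable {A : E →L[ℝ] E} {P : E → Measure E}

theorem IsGaussianLocation.eq_map_add (h : IsGaussianLocation A P) (β : E) :
    P β = (P 0).map (fun x => β + x) := by
  have := h.prob
  have hm : Measurable fun x : E => β + x := by fun_prop
  have := Measure.isProbabilityMeasure_map (μ := P 0) hm.aemeasurable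
  refine ext_of_integral_exp_inner (h.integrable_exp β) fun t => ?_
  rw [h.integral_exp, integral_map hm.aemeasurable (by fun_prop)]
  simp_rw [inner_add_right, Real.exp_add]
  rw [integral_const_mul, h.integral_exp, inner_zero_right, zero_add]

/-- Tilting by `exp ⟪w, ·⟫` multiplies the Laplace transform at `t` into the one at `w + t`;
completing the square shows a shift of the location by `A w`. -/
theorem IsGaussianLocation.add_map_eq_withDensity (h : IsGaussianLocation A P) (β w : E) :
    P (β + A w) = (P β).withDensity
      (fun x => ENNReal.ofReal (Real.exp (⟪w, x⟫ - (⟪w, β⟫ + ⟪w, A w⟫ / 2)))) := by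
  have := h.prob
  set c := ⟪w, β⟫ + ⟪w, A w⟫ / 2 with hc
  have hd : ∀ x : E, Real.exp (⟪w, x⟫ - c) = Real.exp (-c) * Real.exp ⟪w, x⟫ := fun x => by
    rw [← Real.exp_add]; ring_nf
  have hint : Integrable (fun x : E => Real.exp (⟪w, x⟫ - c)) (P β) := by
    simp_rw [hd]; exact (h.integrable_exp β w).const_mul _
  have hfin : IsFiniteMeasure ((P β).withDensity
      (fun x => ENNReal.ofReal (Real.exp (⟪w, x⟫ - c)))) :=
    isFiniteMeasure_withDensity_ofReal hint.2
  refine ext_of_integral_exp_inner (h.integrable_exp _) fun t => ?_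
  rw [h.integral_exp, integral_withDensity_eq_integral_toReal_smul (by fun_prop)
    (Filter.Eventually.of_forall fun x => by simp)]
  have : ∀ x : E, (ENNReal.ofReal (Real.exp (⟪w, x⟫ - c))).toReal • Real.exp ⟪t, x⟫ =
      Real.exp (-c) * Real.exp ⟪w + t, x⟫ := fun x => by
    rw [ENNReal.toReal_ofReal (Real.exp_nonneg _), hd, smul_eq_mul, mul_assoc, ← Real.exp_add,
      inner_add_left]
  simp_rw [this]
  rw [integral_const_mul, h.integral_exp, ← Real.exp_add, hc]
  congr 1
  have h1 : ⟪w, A t⟫ = ⟪t, A w⟫ := by rw [h.symm, real_inner_comm]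
  simp only [inner_add_left, inner_add_right, map_add, h1]
  ring

/-- When `A` is surjective, every shift of the location is a tilt. -/
theorem IsGaussianLocation.absolutelyContinuous (h : IsGaussianLocation A P)
    (hA : Function.Surjective A) (β β' : E) : P β ≪ P β' := by
  obtain ⟨w, hw⟩ := hA (β - β')
  have : β = β' + A w := by rw [hw]; abel
  rw [this, h.add_map_eq_withDensity]
  exact withDensity_absolutelyContinuous _ _

/-- The residual and the linear statistic are independent, and the latter is normal. -/
theorem IsGaussianLocation.eq_map_prod (h : IsGaussianLocation A P) {u c : E} {v : NNReal}
    (hv : v ≠ 0) (hu : ⟪u, A u⟫ = v) (hc : c = (v : ℝ)⁻¹ • A u) (β : E) :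
    P β = (((P β).map (resid u c)).prod (gaussianReal ⟪u, β⟫ v)).map
      (fun p : E × ℝ => p.1 + p.2 • c) := by
  have := h.prob
  have hv' : (v : ℝ) ≠ 0 := by exact_mod_cast hv
  have hm : Measurable fun p : E × ℝ => p.1 + p.2 • c := by fun_prop
  have hr := measurable_resid (E := E) u c
  have := Measure.isProbabilityMeasure_map (μ := P β) hr.aemeasurable
  have := Measure.isProbabilityMeasure_map
    (μ := ((P β).map (resid u c)).prod (gaussianReal ⟪u, β⟫ v)) hm.aemeasurable
  refine ext_of_integral_exp_inner (h.integrable_exp β) fun t => ?_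
  rw [h.integral_exp, integral_map hm.aemeasurable (by fun_prop)]
  simp only [inner_add_right, inner_smul_right, Real.exp_add]
  have hA : ⟪t, A u⟫ = ⟪t, c⟫ * v := by
    rw [hc, inner_smul_right]; field_simp
  have hA' : ⟪u, A t⟫ = ⟪t, c⟫ * v := by rw [h.symm, real_inner_comm, hA]
  rw [integral_prod_mul (fun r : E => Real.exp ⟪t, r⟫) (fun z : ℝ => Real.exp (z * ⟪t, c⟫)),
    integral_map hr.aemeasurable (by fun_prop)]
  simp_rw [inner_resid]
  rw [h.integral_exp]
  have hg : ∫ z, Real.exp (z * ⟪t, c⟫) ∂(gaussianReal ⟪u, β⟫ v) =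
      Real.exp (⟪u, β⟫ * ⟪t, c⟫ + v * ⟪t, c⟫ ^ 2 / 2) := by
    have := congrFun (mgf_fun_id_gaussianReal (μ := ⟪u, β⟫) (v := v)) ⟪t, c⟫
    rw [← this, mgf]; simp_rw [mul_comm]
  rw [hg, ← Real.exp_add, ← Real.exp_add]
  -- With `t₀ = t - ⟪t, c⟫ • u`, the cross term of the quadratic form vanishes, since `⟪t₀, A u⟫ =
  -- 0` by the choice of `c`.
  congr 1
  simp only [inner_sub_left, inner_sub_right, inner_smul_left, inner_smul_right, map_sub, map_smul,
    hA, hA', hu]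
  simp
  ring

theorem IsGaussianLocation.measure_eq_lintegral (h : IsGaussianLocation A P) {u c : E} {v : NNReal}
    (hv : v ≠ 0) (hu : ⟪u, A u⟫ = v) (hc : c = (v : ℝ)⁻¹ • A u) (β : E) {M : Set E}
    (hM : MeasurableSet M) :
    P β M = ∫⁻ r, gaussianReal ⟪u, β⟫ v {z | r + z • c ∈ M} ∂((P β).map (resid u c)) := by
  have hm : Measurable fun p : E × ℝ => p.1 + p.2 • c := by fun_prop
  conv_lhs => rw [h.eq_map_prod hv hu hc β]
  rw [Measure.map_apply hm hM, Measure.prod_apply (hm hM)]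
  rfl

/-- Almost every `r` is orthogonal to `u`, so `r + z • c` has residual `r` and the condition on the
residual only restricts the outer integral. -/
theorem IsGaussianLocation.measure_inter_preimage_resid (h : IsGaussianLocation A P) {u c : E}
    {v : NNReal} (hv : v ≠ 0) (hu : ⟪u, A u⟫ = v) (hc : c = (v : ℝ)⁻¹ • A u) (β : E) {M D : Set E}
    (hM : MeasurableSet M) (hD : MeasurableSet D) :
    P β (M ∩ resid u c ⁻¹' D) =
      ∫⁻ r in D, gaussianReal ⟪u, β⟫ v {z | r + z • c ∈ M} ∂((P β).map (resid u c)) := by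
  have hv' : (v : ℝ) ≠ 0 := by exact_mod_cast hv
  have huc : ⟪u, c⟫ = 1 := by rw [hc, inner_smul_right, hu]; field_simp
  rw [h.measure_eq_lintegral hv hu hc β (hM.inter (measurable_resid u c hD)),
    ← lintegral_indicator hD]
  refine lintegral_congr_ae ?_
  filter_upwards [ae_inner_eq_zero_map_resid huc (P β)] with r hr
  by_cases hrD : r ∈ D <;> simp [resid_add_smul huc hr, hrD]

/-- Turns Laplace transforms of `P β` restricted to an event into probabilities of that event at
other locations, which is where hypotheses on all `β` enter. -/
theorem IsGaussianLocation.setIntegral_exp_inner (h : IsGaussianLocation A P) (β w : E) {M : Set E}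
    (hM : MeasurableSet M) :
    ∫ x in M, Real.exp ⟪w, x⟫ ∂(P β) =
      Real.exp (⟪w, β⟫ + ⟪w, A w⟫ / 2) * (P (β + A w)).real M := by
  set k := ⟪w, β⟫ + ⟪w, A w⟫ / 2 with hk
  have hd : ∀ x : E, Real.exp ⟪w, x⟫ = Real.exp k * Real.exp (⟪w, x⟫ - k) := fun x => by
    rw [← Real.exp_add]; ring_nf
  simp_rw [hd]
  rw [integral_const_mul, integral_eq_lintegral_of_nonneg_ae
    (Filter.Eventually.of_forall fun x => Real.exp_nonneg _) (by fun_prop), measureReal_def,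
    h.add_map_eq_withDensity, withDensity_apply _ hM]

/-- Completeness: an identity between the probabilities of two events that holds for all locations
at a given value of the linear statistic holds conditionally on the residual. -/
theorem IsGaussianLocation.ae_measure_section_eq (h : IsGaussianLocation A P)
    (hA : Function.Surjective A) {u c : E} {v : NNReal} (hv : v ≠ 0) (hu : ⟪u, A u⟫ = v)
    (hc : c = (v : ℝ)⁻¹ • A u) {M B : Set E} (hM : MeasurableSet M) (hB : MeasurableSet B)
    {a : ℝ≥0∞} (ha : a ≠ ∞) {m : ℝ} (hMB : ∀ β, ⟪u, β⟫ = m → P β M = a * P β B) (β : E) :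
    ∀ᵐ r ∂((P β).map (resid u c)),
      gaussianReal m v {z | r + z • c ∈ M} = a * gaussianReal m v {z | r + z • c ∈ B} := by
  have := h.prob
  have hv' : (v : ℝ) ≠ 0 := by exact_mod_cast hv
  have huc : ⟪u, c⟫ = 1 := by rw [hc, inner_smul_right, hu]; field_simp
  have hr := measurable_resid (E := E) u c
  have hac : (P β).map (resid u c) ≪ (P (m • c)).map (resid u c) :=
    (h.absolutelyContinuous hA _ _).map hr
  -- Null sets do not depend on the location, so it can be moved to a point of the hyperplane `⟪u,
  -- ·⟫ = m`.
  refine hac.ae_le ?_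
  set β₀ := m • c with hβ₀
  have hm : ⟪u, β₀⟫ = m := by rw [hβ₀, inner_smul_right, huc, mul_one]
  have hrestr : ∀ N : Set E, ∀ t : E,
      Integrable (fun x => Real.exp ⟪t, x⟫) (((P β₀).restrict N).map (resid u c)) := by
    intro N t
    rw [integrable_map_measure (by fun_prop) hr.aemeasurable]
    simp only [Function.comp_def, inner_resid]
    exact (h.integrable_exp _ _).restrict
  have hfin : IsFiniteMeasure (a • (((P β₀).restrict B).map (resid u c))) :=
    Measure.smul_finite _ ha
  have heq : ((P β₀).restrict M).map (resid u c) = a • (((P β₀).restrict B).map (resid u c)) := by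
    refine ext_of_integral_exp_inner (hrestr M) fun t => ?_
    rw [integral_smul_measure, integral_map hr.aemeasurable (by fun_prop),
      integral_map hr.aemeasurable (by fun_prop)]
    simp_rw [inner_resid]
    rw [h.setIntegral_exp_inner _ _ hM, h.setIntegral_exp_inner _ _ hB]
    -- The exponents that arise from residuals shift the location orthogonally to `u`, so it stays
    -- on the hyperplane and `hMB` applies.
    have hw : ⟪u, β₀ + A (t - ⟪t, c⟫ • u)⟫ = m := by
      have h1 : ⟪t, A u⟫ = ⟪t, c⟫ * v := by rw [hc, inner_smul_right]; field_simp
      have h2 : ⟪u, A t⟫ = ⟪t, c⟫ * v := by rw [h.symm, real_inner_comm, h1]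
      rw [inner_add_right, hm, map_sub, map_smul, inner_sub_right, inner_smul_right, hu, h2]
      ring
    rw [measureReal_def, hMB _ hw, ENNReal.toReal_mul, measureReal_def, smul_eq_mul]
    ring
  refine ae_eq_of_forall_setLIntegral_eq_of_sigmaFinite
    (measurable_gaussianReal_section c m v hM)
    ((measurable_gaussianReal_section c m v hB).const_mul a) fun D hD _ => ?_
  have hDeq := congrArg (fun μ : Measure E => μ D) heq
  simp only [Measure.smul_apply, Measure.map_apply hr hD, Measure.restrict_apply (hr hD),
    smul_eq_mul] at hDeq
  rw [Set.inter_comm, h.measure_inter_preimage_resid hv hu hc _ hM hD, Set.inter_comm,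
    h.measure_inter_preimage_resid hv hu hc _ hB hD, hm] at hDeq
  rw [lintegral_const_mul _ (measurable_gaussianReal_section c m v hB)]
  exact hDeq

end GaussianLocation

/-- If `B` were null for one location it would be null for all. By Fubini and translation
invariance, the integral of `P β B` over `β` against Lebesgue measure is `volume B`, a
contradiction. -/
theorem IsGaussianLocation.measure_pos {E : Type*} [NormedAddCommGroup E] [InnerProductSpace ℝ E]
    [FiniteDimensional ℝ E] [MeasurableSpace E] [BorelSpace E] {A : E →L[ℝ] E} {P : E → Measure E}
    [CompleteSpace E] [SecondCountableTopology E]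
    (h : IsGaussianLocation A P) (hA : Function.Surjective A) {B : Set E}
    (hB : MeasurableSet B) (hpos : 0 < volume B) (β : E) : 0 < P β B := by
  have := h.prob
  by_contra hcon
  have h0 : ∀ β', P β' B = 0 := fun β' =>
    h.absolutelyContinuous hA β' β (nonpos_iff_eq_zero.1 (not_lt.1 hcon))
  have hm : Measurable fun p : E × E => p.1 + p.2 := by fun_prop
  have h1 : ((volume : Measure E).prod (P 0)) ((fun p : E × E => p.1 + p.2) ⁻¹' B) = 0 := by
    rw [Measure.prod_apply (hm hB)]
    refine (lintegral_congr fun β' => ?_).trans lintegral_zero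
    have := h0 β'
    rw [h.eq_map_add, Measure.map_apply (by fun_prop) hB] at this
    exact this
  rw [Measure.prod_apply_symm (hm hB)] at h1
  have h2 : ∀ x : E, volume ((fun y => (y, x)) ⁻¹' ((fun p : E × E => p.1 + p.2) ⁻¹' B)) =
      volume B := fun x => measure_preimage_add_right volume x B
  simp [h2] at h1
  exact hpos.ne' h1

/-! ### Quantiles, Neyman–Pearson and normal laws on the line -/

section RealLine

/-- Probability integral transform for a finite measure without atoms. -/
theorem measure_setOf_le_measure_Iic {ν : Measure ℝ} [IsFiniteMeasure ν] [NullSingletonClass ν]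
    {p : ℝ≥0∞} (h0 : 0 < p) (h1 : p < ν Set.univ) :
    ν {z | p ≤ ν (Set.Iic z)} = ν Set.univ - p := by
  set U := {z | p ≤ ν (Set.Iic z)} with hU
  have hup : ∀ {x y}, x ∈ U → x ≤ y → y ∈ U := fun hx hxy =>
    le_trans hx (measure_mono (Set.Iic_subset_Iic.2 hxy))
  have hne : U.Nonempty :=
    ((tendsto_measure_Iic_atTop ν).eventually (le_mem_nhds h1)).exists
  have hbdd : BddBelow U := by
    have hlt : ν Set.univ - p < ν Set.univ :=
      ENNReal.sub_lt_self (measure_ne_top _ _) (h0.trans h1).ne' h0.ne'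
    obtain ⟨x, hx⟩ := ((tendsto_measure_Ici_atBot ν).eventually (lt_mem_nhds hlt)).exists
    refine ⟨x, fun z hz => ?_⟩
    by_contra hzx
    have hdisj : Disjoint (Set.Iic z) (Set.Ici x) :=
      Set.disjoint_left.2 fun t ht ht' => hzx (le_trans (Set.mem_Ici.1 ht') ht)
    have hsum : ν (Set.Iic z) + ν (Set.Ici x) ≤ ν Set.univ := by
      rw [← measure_union hdisj measurableSet_Ici]; exact measure_mono (Set.subset_univ _)
    have h2 : ν Set.univ < p + ν (Set.Ici x) := by
      have := ENNReal.add_lt_add_left h1.ne_top hx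
      rwa [add_tsub_cancel_of_le h1.le] at this
    exact absurd (le_trans (add_le_add_left hz _) hsum) (not_le.2 h2)
  set c := sInf U with hc
  have hIoi : ∀ z, c < z → z ∈ U := fun z hz => by
    obtain ⟨y, hy, hyz⟩ := exists_lt_of_csInf_lt hne hz
    exact hup hy hyz.le
  have hIio : ∀ z, z < c → ν (Set.Iic z) ≤ p := fun z hz =>
    le_of_lt (not_le.1 fun hzU => absurd (csInf_le hbdd hzU) (not_le.2 hz))
  -- Points left of `c` lie outside `U`, and absence of atoms allows the limit from the left. With
  -- `hge` this makes the mass up to `c` exactly `p`.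
  have hle : ν (Set.Iic c) ≤ p := by
    obtain ⟨u, hu, huc, hut⟩ := exists_seq_strictMono_tendsto c
    rw [← measure_congr (Iio_ae_eq_Iic (μ := ν) (a := c)),
      ← iUnion_Iic_eq_Iio_of_lt_of_tendsto huc hut,
      Monotone.measure_iUnion fun i j hij => Set.Iic_subset_Iic.2 (hu.monotone hij)]
    exact iSup_le fun n => hIio _ (huc n)
  have hge : p ≤ ν (Set.Iic c) := by
    obtain ⟨u, hu, huc, hut⟩ := exists_seq_strictAnti_tendsto c
    have : Set.Iic c = ⋂ n, Set.Iic (u n) := by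
      ext x
      simp only [Set.mem_Iic, Set.mem_iInter]
      exact ⟨fun h n => h.trans (huc n).le, fun h => ge_of_tendsto' hut h⟩
    rw [this, Antitone.measure_iInter (fun i j hij => Set.Iic_subset_Iic.2 (hu.antitone hij))
      (fun _ => measurableSet_Iic.nullMeasurableSet) ⟨0, measure_ne_top _ _⟩]
    exact le_iInf fun n => hIoi _ (huc n)
  have hUeq : ν U = ν (Set.Ioi c) := by
    refine le_antisymm ?_ (measure_mono hIoi)
    rw [measure_congr (Ioi_ae_eq_Ici (μ := ν) (a := c))]
    exact measure_mono fun z hz => csInf_le hbdd hz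
  rw [hUeq, ← Set.compl_Iic, measure_compl measurableSet_Iic (measure_ne_top _ _),
    le_antisymm hle hge]

theorem measurableSet_setOf_le_measure_Iic (ν : Measure ℝ) (p : ℝ≥0∞) :
    MeasurableSet {z | p ≤ ν (Set.Iic z)} :=
  (IsUpperSet.ordConnected fun _ _ h hx =>
    le_trans hx (measure_mono (Set.Iic_subset_Iic.2 h))).measurableSet

/-- For a measure without atoms, almost every point has mass on both of its sides. -/
theorem ae_measure_Iic_pos_and_measure_Ioi_pos (ν : Measure ℝ) [IsFiniteMeasure ν]
    [NullSingletonClass ν] : ∀ᵐ z ∂ν, 0 < ν (Set.Iic z) ∧ 0 < ν (Set.Ioi z) := by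
  rcases eq_or_ne ν 0 with rfl | hν
  · simp
  have hpos : 0 < ν Set.univ := by simpa [pos_iff_ne_zero] using hν
  have hfin := measure_ne_top ν Set.univ
  rw [Filter.eventually_and]
  constructor
  -- For each small `p > 0` the exceptional points lie in the lower tail of mass `p`. The other half
  -- uses the upper tail.
  · refine nonpos_iff_eq_zero.1 (le_of_forall_pos_le_add fun p hp => ?_)
    rw [zero_add]
    rcases le_or_gt (ν Set.univ) p with hle | hlt
    · exact (measure_mono (Set.subset_univ _)).trans hle
    have hsub : {z | ¬ 0 < ν (Set.Iic z)} ⊆ {z | p ≤ ν (Set.Iic z)}ᶜ := fun z hz hz' =>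
      hz (hp.trans_le hz')
    refine (measure_mono hsub).trans ?_
    rw [measure_compl (measurableSet_setOf_le_measure_Iic ν p) (measure_ne_top _ _),
      measure_setOf_le_measure_Iic hp hlt, ENNReal.sub_sub_cancel hfin hlt.le]
  · refine nonpos_iff_eq_zero.1 (le_of_forall_pos_le_add fun e he => ?_)
    rw [zero_add]
    rcases le_or_gt (ν Set.univ) e with hle | hlt
    · exact (measure_mono (Set.subset_univ _)).trans hle
    have hsub : {z | ¬ 0 < ν (Set.Ioi z)} ⊆ {z | ν Set.univ - e ≤ ν (Set.Iic z)} := fun z hz => by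
      have h0 : ν (Set.Ioi z) = 0 := nonpos_iff_eq_zero.1 (not_lt.1 hz)
      have : ν Set.univ = ν (Set.Iic z) := by
        rw [← measure_add_measure_compl (μ := ν) (s := Set.Iic z) measurableSet_Iic, Set.compl_Iic,
          h0, add_zero]
      rw [Set.mem_ofPred_eq, this]; exact tsub_le_self
    refine (measure_mono hsub).trans ?_
    rw [measure_setOf_le_measure_Iic (tsub_pos_of_lt hlt)
      (ENNReal.sub_lt_self hfin hpos.ne' he.ne'), ENNReal.sub_sub_cancel hfin hlt.le]

/-- Neyman–Pearson comparison: among sets of equal mass, the one that contains the larger values of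
the density has the larger mass with respect to that density. -/
theorem withDensity_le_withDensity_of_threshold {ν : Measure ℝ} [IsFiniteMeasure ν]
    {g : ℝ → ℝ≥0∞} {Q C : Set ℝ} (hQ : MeasurableSet Q) (hC : MeasurableSet C)
    (hQC : ν Q = ν C) (k : ℝ≥0∞) (hk : ∀ x ∈ Q \ C, g x ≤ k) (hk' : ∀ x ∈ C \ Q, k ≤ g x) :
    ν.withDensity g Q ≤ ν.withDensity g C := by
  have hdiff : ν (Q \ C) = ν (C \ Q) := by
    have h1 := measure_sdiff_add_inter (μ := ν) Q hC
    have h2 := measure_sdiff_add_inter (μ := ν) C hQ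
    rw [Set.inter_comm, ← hQC, ← h1, Set.inter_comm] at h2
    exact ((ENNReal.add_left_inj (measure_ne_top _ _)).1 (by rw [h2])).symm
  rw [← measure_sdiff_add_inter (μ := ν.withDensity g) Q hC,
    ← measure_sdiff_add_inter (μ := ν.withDensity g) C hQ, Set.inter_comm C Q]
  refine add_le_add_left ?_ _
  rw [withDensity_apply _ (hQ.diff hC), withDensity_apply _ (hC.diff hQ)]
  calc ∫⁻ x in Q \ C, g x ∂ν ≤ ∫⁻ _ in Q \ C, k ∂ν := setLIntegral_mono measurable_const hk
    _ = ∫⁻ _ in C \ Q, k ∂ν := by rw [setLIntegral_const, setLIntegral_const, hdiff]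
    _ ≤ ∫⁻ x in C \ Q, g x ∂ν := setLIntegral_mono' (hC.diff hQ) hk'

/-- Two sets of reals that are separated in the order are separated by a monotone function. -/
theorem exists_forall_le_forall_ge_of_monotone {g : ℝ → ℝ≥0∞} (hg : Monotone g) {X Y : Set ℝ}
    (h : ∀ x ∈ X, ∀ y ∈ Y, x ≤ y) : ∃ k, (∀ x ∈ X, g x ≤ k) ∧ ∀ y ∈ Y, k ≤ g y :=
  ⟨⨆ x ∈ X, g x, fun x hx => le_iSup₂ (f := fun x (_ : x ∈ X) => g x) x hx,
    fun y hy => iSup₂_le fun x hx => hg (h x hx y hy)⟩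

theorem exists_forall_le_forall_ge_of_antitone {g : ℝ → ℝ≥0∞} (hg : Antitone g) {X Y : Set ℝ}
    (h : ∀ x ∈ X, ∀ y ∈ Y, x ≤ y) : ∃ k, (∀ x ∈ X, k ≤ g x) ∧ ∀ y ∈ Y, g y ≤ k :=
  ⟨⨆ y ∈ Y, g y, fun x hx => iSup₂_le fun y hy => hg (h x hx y hy),
    fun y hy => le_iSup₂ (f := fun x (_ : x ∈ Y) => g x) y hy⟩

theorem isGaussianLocation_gaussianReal (v : NNReal) :
    IsGaussianLocation ((v : ℝ) • ContinuousLinearMap.id ℝ ℝ) (fun m => gaussianReal m v) where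
  prob _ := inferInstance
  symm x y := by simp; ring
  integrable_exp m t := by
    simpa [mul_comm] using integrable_exp_mul_gaussianReal (μ := m) (v := v) t
  integral_exp m t := by
    have := congrFun (mgf_fun_id_gaussianReal (μ := m) (v := v)) t
    simp only [mgf] at this
    simp only [RCLike.inner_apply, conj_trivial, mul_comm _ t, this]
    simp; ring

theorem gaussianReal_eq_withDensity {v : NNReal} (hv : v ≠ 0) (m m' : ℝ) :
    ∃ k : ℝ, gaussianReal m' v = (gaussianReal m v).withDensity
      (fun x => ENNReal.ofReal (Real.exp ((m' - m) / v * x - k))) := by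
  have hv' : (v : ℝ) ≠ 0 := by exact_mod_cast hv
  have := (isGaussianLocation_gaussianReal v).add_map_eq_withDensity m ((m' - m) / v)
  have hmean : m + ((v : ℝ) • ContinuousLinearMap.id ℝ ℝ) ((m' - m) / v) = m' := by
    simp; field_simp; ring
  rw [hmean] at this
  simp only [RCLike.inner_apply, conj_trivial, mul_comm _ ((m' - m) / (v : ℝ))] at this
  exact ⟨_, this⟩

/-- The one-sided test based on the distribution function has the nominal size. -/
theorem measure_inter_setOf_le {ν : Measure ℝ} [IsFiniteMeasure ν] [NullSingletonClass ν]
    (T : Set ℝ) {α : ℝ} (hα : α ∈ Set.Ioo (0 : ℝ) 1) :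
    ν {z | z ∈ T ∧ ENNReal.ofReal (1 - α) * ν T ≤ ν (Set.Iic z ∩ T)} = ENNReal.ofReal α * ν T := by
  rcases eq_or_ne (ν T) 0 with h0 | h0
  · rw [h0]
    simp only [mul_zero]
    exact measure_mono_null (Set.sep_subset T _) h0
  have hfin := measure_ne_top ν T
  have huniv : (ν.restrict T) Set.univ = ν T := by simp
  have h1 : ENNReal.ofReal (1 - α) < 1 := by
    rw [← ENNReal.ofReal_one]; exact (ENNReal.ofReal_lt_ofReal_iff one_pos).2 (by linarith [hα.1])
  have key := measure_setOf_le_measure_Iic (ν := ν.restrict T) (p := ENNReal.ofReal (1 - α) * ν T)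
    (ENNReal.mul_pos (by simpa using hα.2) h0) (by
      rw [huniv]; simpa using ENNReal.mul_lt_mul_left h0 hfin h1)
  rw [Measure.restrict_apply (measurableSet_setOf_le_measure_Iic _ _), huniv] at key
  have hset : {z | z ∈ T ∧ ENNReal.ofReal (1 - α) * ν T ≤ ν (Set.Iic z ∩ T)} =
      {z | ENNReal.ofReal (1 - α) * ν T ≤ (ν.restrict T) (Set.Iic z)} ∩ T := by
    ext z; simp [Measure.restrict_apply measurableSet_Iic, and_comm]
  rw [hset, key]
  have hsum : ENNReal.ofReal α * ν T + ENNReal.ofReal (1 - α) * ν T = ν T := by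
    rw [← add_mul, ← ENNReal.ofReal_add hα.1.le (by linarith [hα.2])]; simp
  conv_lhs => rw [← hsum]
  rw [hsum]
  exact ENNReal.sub_eq_of_eq_add (ENNReal.mul_ne_top ENNReal.ofReal_ne_top hfin) hsum.symm

end RealLine

/-! ### The truncated normal family: unique crossing and optimal one-sided tests -/

section TruncatedNormal

theorem mgf_strictMono_of_pos {Ω : Type*} [MeasurableSpace Ω] {ν : Measure Ω} (hν : ν ≠ 0)
    {X : Ω → ℝ} (hX : ∀ᵐ x ∂ν, 0 < X x)
    (hint : ∀ t : ℝ, Integrable (fun x => Real.exp (t * X x)) ν) : StrictMono (mgf X ν) := by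
  intro s t hst
  rw [← sub_pos, mgf, mgf, ← integral_sub (hint t) (hint s)]
  have hpos : ∀ᵐ x ∂ν, 0 < Real.exp (t * X x) - Real.exp (s * X x) := by
    filter_upwards [hX] with x hx
    exact sub_pos.2 (Real.exp_lt_exp.2 (mul_lt_mul_of_pos_right hst hx))
  refine (integral_pos_iff_support_of_nonneg_ae (hpos.mono fun x hx => hx.le)
    ((hint t).sub (hint s))).2 ?_
  rw [measure_congr (Filter.eventuallyEq_set.2 (hpos.mono fun x hx => ?_) :
    Function.support (fun x => Real.exp (t * X x) - Real.exp (s * X x)) =ᵐ[ν] Set.univ)]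
  · simpa [pos_iff_ne_zero] using hν
  · simp [hx.ne']

/-- The bound `t * X ≤ exp (t * X)` leaves a linear lower bound whose slope, the integral of `X`, is
positive. -/
theorem tendsto_mgf_atTop_of_pos {Ω : Type*} [MeasurableSpace Ω] {ν : Measure Ω}
    [IsFiniteMeasure ν] (hν : ν ≠ 0) {X : Ω → ℝ} (hX : ∀ᵐ x ∂ν, 0 < X x)
    (hint : ∀ t : ℝ, Integrable (fun x => Real.exp (t * X x)) ν) :
    Filter.Tendsto (mgf X ν) Filter.atTop Filter.atTop := by
  have hXint : Integrable X ν := integrable_of_mem_interior_integrableExpSet (by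
    rw [show integrableExpSet X ν = Set.univ from Set.eq_univ_of_forall hint]; simp)
  have hmean : 0 < ∫ x, X x ∂ν := by
    refine (integral_pos_iff_support_of_nonneg_ae (hX.mono fun x hx => hx.le) hXint).2 ?_
    rw [measure_congr (Filter.eventuallyEq_set.2 (hX.mono fun x hx => ?_) :
      Function.support X =ᵐ[ν] Set.univ)]
    · simpa [pos_iff_ne_zero] using hν
    · simp [hx.ne']
  refine Filter.tendsto_atTop_mono (fun t => ?_)
    (Filter.tendsto_id.atTop_mul_const hmean)
  rw [id, ← integral_const_mul, mgf]
  refine integral_mono (hXint.const_mul t) (hint t) fun x => ?_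
  linarith [Real.add_one_le_exp (t * X x)]

/-- Two weighted Laplace transforms of positive variables with opposite arguments cross once. -/
theorem exists_mgf_crossing {Ω : Type*} [MeasurableSpace Ω] {ν₁ ν₂ : Measure Ω} [IsFiniteMeasure ν₁]
    [IsFiniteMeasure ν₂] (hν₁ : ν₁ ≠ 0) (hν₂ : ν₂ ≠ 0) {X₁ X₂ : Ω → ℝ} (hX₁ : ∀ᵐ x ∂ν₁, 0 < X₁ x)
    (hX₂ : ∀ᵐ x ∂ν₂, 0 < X₂ x) (hint₁ : ∀ t : ℝ, Integrable (fun x => Real.exp (t * X₁ x)) ν₁)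
    (hint₂ : ∀ t : ℝ, Integrable (fun x => Real.exp (t * X₂ x)) ν₂) {a b : ℝ} (ha : 0 < a)
    (hb : 0 < b) :
    ∃ w, ∀ s, (b * mgf X₂ ν₂ s ≤ a * mgf X₁ ν₁ (-s) ↔ s ≤ w) ∧
      (a * mgf X₁ ν₁ (-s) ≤ b * mgf X₂ ν₂ s ↔ w ≤ s) := by
  have hm₁ := mgf_strictMono_of_pos hν₁ hX₁ hint₁
  have hm₂ := mgf_strictMono_of_pos hν₂ hX₂ hint₂
  have ht₁ := tendsto_mgf_atTop_of_pos hν₁ hX₁ hint₁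
  have ht₂ := tendsto_mgf_atTop_of_pos hν₂ hX₂ hint₂
  set D : ℝ → ℝ := fun s => b * mgf X₂ ν₂ s - a * mgf X₁ ν₁ (-s) with hD
  have hDm : StrictMono D := fun s t hst => by
    have h1 := mul_lt_mul_of_pos_left (hm₂ hst) hb
    have h2 := mul_lt_mul_of_pos_left (hm₁ (neg_lt_neg hst)) ha
    simp only [hD]; linarith
  have hDc : Continuous D := by
    have := continuous_mgf hint₁
    have := continuous_mgf hint₂
    fun_prop
  have hpos : ∃ s, 0 ≤ D s := by
    obtain ⟨s, hs, hs0⟩ := ((ht₂.const_mul_atTop hb).eventually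
      (Filter.eventually_ge_atTop (a * mgf X₁ ν₁ 0))).and (Filter.eventually_ge_atTop 0) |>.exists
    have := mul_le_mul_of_nonneg_left (hm₁.monotone (neg_nonpos.2 hs0)) ha.le
    exact ⟨s, by simp only [hD]; linarith⟩
  have hneg : ∃ s, D s ≤ 0 := by
    obtain ⟨s, hs, hs0⟩ := ((ht₁.const_mul_atTop ha).eventually
      (Filter.eventually_ge_atTop (b * mgf X₂ ν₂ 0))).and (Filter.eventually_ge_atTop 0) |>.exists
    have := mul_le_mul_of_nonneg_left (hm₂.monotone (neg_nonpos.2 hs0)) hb.le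
    exact ⟨-s, by simp only [hD, neg_neg]; linarith⟩
  obtain ⟨w, hw⟩ := mem_range_of_exists_le_of_exists_ge hDc hneg hpos
  refine ⟨w, fun s => ⟨?_, ?_⟩⟩
  · rw [show s ≤ w ↔ D s ≤ D w from hDm.le_iff_le.symm, hw, hD, sub_nonpos]
  · rw [show w ≤ s ↔ D w ≤ D s from hDm.le_iff_le.symm, hw, hD, sub_nonneg]

variable {v : NNReal}

theorem gaussianReal_real_eq_integral (hv : v ≠ 0) (m : ℝ) :
    ∃ k : ℝ, ∀ S : Set ℝ, MeasurableSet S → (gaussianReal m v).real S =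
      Real.exp k * ∫ x in S, Real.exp (m / v * x) ∂(gaussianReal 0 v) := by
  obtain ⟨k, hk⟩ := gaussianReal_eq_withDensity hv 0 m
  refine ⟨-k, fun S hS => ?_⟩
  rw [hk, measureReal_def, withDensity_apply _ hS, ← integral_const_mul,
    integral_eq_lintegral_of_nonneg_ae
      (Filter.Eventually.of_forall fun x => by positivity) (by fun_prop)]
  congr 2
  ext x
  rw [← Real.exp_add, sub_zero]; ring_nf

theorem gaussianReal_absolutelyContinuous_gaussianReal (hv : v ≠ 0) (m m' : ℝ) :
    gaussianReal m v ≪ gaussianReal m' v :=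
  (gaussianReal_absolutelyContinuous m hv).trans (gaussianReal_absolutelyContinuous' m' hv)

theorem ne_zero_of_coe_eq_sq {σ : ℝ} (hσ : 0 < σ) (hσv : (v : ℝ) = σ ^ 2) : v ≠ 0 := by
  have : (0 : ℝ) < v := by rw [hσv]; positivity
  exact_mod_cast this.ne'

theorem truncCDF_eq_div {σ : ℝ} (hσ : 0 < σ) (hσv : (v : ℝ) = σ ^ 2) (z m : ℝ) (T : Set ℝ) :
    truncCDF z m σ T =
      (gaussianReal m v).real (Set.Iic z ∩ T) / (gaussianReal m v).real T := by
  have hv := ne_zero_of_coe_eq_sq hσ hσv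
  have hpdf : ∀ t, gaussianPDFReal m v t = σ⁻¹ * gaussianPDFReal 0 1 ((t - m) / σ) := by
    intro t
    simp only [gaussianPDFReal, hσv, NNReal.coe_one, mul_one, sub_zero]
    rw [Real.sqrt_mul (by positivity), Real.sqrt_sq hσ.le, mul_inv, mul_comm _ σ⁻¹, mul_assoc]
    congr 3
    field_simp
  have hreal : ∀ S : Set ℝ, (gaussianReal m v).real S =
      σ⁻¹ * ∫ t in S, gaussianPDFReal 0 1 ((t - m) / σ) := by
    intro S
    rw [measureReal_def, gaussianReal_apply_eq_integral m hv, ENNReal.toReal_ofReal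
      (integral_nonneg fun t => gaussianPDFReal_nonneg _ _ _), ← integral_const_mul]
    simp_rw [hpdf]
  rw [hreal, hreal, mul_div_mul_left _ _ (inv_ne_zero hσ.ne'), truncCDF]

theorem measureReal_Iic_add_Ioi (μ : Measure ℝ) [IsFiniteMeasure μ] (z : ℝ) (T : Set ℝ) :
    μ.real (Set.Iic z ∩ T) + μ.real (Set.Ioi z ∩ T) = μ.real T := by
  rw [Set.inter_comm, Set.inter_comm (Set.Ioi z), ← Set.compl_Iic, ← Set.sdiff_eq]
  exact measureReal_inter_add_sdiff (s := T) measurableSet_Iic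

/-- The distribution function of a truncated normal law, as a function of the mean, crosses each
level in `(0, 1)` exactly once when the truncation set has mass on both sides of the argument. -/
theorem exists_truncCDF_crossing {σ : ℝ} (hσ : 0 < σ) (hσv : (v : ℝ) = σ ^ 2) {z : ℝ} {T : Set ℝ}
    (hT : MeasurableSet T) {α : ℝ} (hα : α ∈ Set.Ioo (0 : ℝ) 1)
    (h1 : gaussianReal 0 v (Set.Iic z ∩ T) ≠ 0) (h2 : gaussianReal 0 v (Set.Ioi z ∩ T) ≠ 0) :
    ∃ w, ∀ m, (1 - α ≤ truncCDF z m σ T ↔ m ≤ w) ∧ (truncCDF z m σ T ≤ 1 - α ↔ w ≤ m) := by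
  have hv := ne_zero_of_coe_eq_sq hσ hσv
  have hv' : (0 : ℝ) < v := by positivity
  have := nullSingletonClass_gaussianReal (μ := 0) hv
  have hm1 : MeasurableSet (Set.Iic z ∩ T) := measurableSet_Iic.inter hT
  have hm2 : MeasurableSet (Set.Ioi z ∩ T) := measurableSet_Ioi.inter hT
  set ν₁ := (gaussianReal 0 v).restrict (Set.Iic z ∩ T) with hν₁
  set ν₂ := (gaussianReal 0 v).restrict (Set.Ioi z ∩ T) with hν₂
  have hint : ∀ c s : ℝ, Integrable (fun x => Real.exp (s * (c * (x - z)))) (gaussianReal 0 v) := by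
    intro c s
    have := (integrable_exp_mul_gaussianReal (μ := 0) (v := v) (s * c)).mul_const
      (Real.exp (-(s * c * z)))
    refine this.congr (Filter.Eventually.of_forall fun x => ?_)
    simp only [← Real.exp_add]; ring_nf
  -- The variables are the distances to `z` on its two sides, and the argument is the natural
  -- parameter `s = m / v`; hence the crossing in `m` at `v * w`.
  obtain ⟨w, hw⟩ := exists_mgf_crossing (ν₁ := ν₁) (ν₂ := ν₂) (X₁ := fun x => -1 * (x - z))
    (X₂ := fun x => 1 * (x - z)) (by rwa [hν₁, Ne, Measure.restrict_eq_zero])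
    (by rwa [hν₂, Ne, Measure.restrict_eq_zero])
    (by
      have hne : ∀ᵐ x ∂ν₁, x ≠ z := by
        rw [ae_iff]; simp
      filter_upwards [ae_restrict_mem hm1, hne] with x hx hxz
      have := lt_of_le_of_ne hx.1 hxz
      linarith)
    (by
      filter_upwards [ae_restrict_mem hm2] with x hx
      have : z < x := hx.1
      linarith)
    (fun s => (hint _ s).restrict) (fun s => (hint _ s).restrict) hα.1 (sub_pos.2 hα.2)
  refine ⟨v * w, fun m => ?_⟩
  obtain ⟨k, hk⟩ := gaussianReal_real_eq_integral hv m
  have hA : (gaussianReal m v).real (Set.Iic z ∩ T) =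
      Real.exp (k + m / v * z) * mgf (fun x => -1 * (x - z)) ν₁ (-(m / v)) := by
    rw [hk _ hm1, mgf, hν₁, ← integral_const_mul, ← integral_const_mul]
    simp only [← Real.exp_add]
    ring_nf
  have hB : (gaussianReal m v).real (Set.Ioi z ∩ T) =
      Real.exp (k + m / v * z) * mgf (fun x => 1 * (x - z)) ν₂ (m / v) := by
    rw [hk _ hm2, mgf, hν₂, ← integral_const_mul, ← integral_const_mul]
    simp only [← Real.exp_add]
    ring_nf
  have hApos : 0 < (gaussianReal m v).real (Set.Iic z ∩ T) :=
    ENNReal.toReal_pos (fun h => h1 (gaussianReal_absolutelyContinuous_gaussianReal hv 0 m h))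
      (measure_ne_top _ _)
  have hBnonneg : 0 ≤ (gaussianReal m v).real (Set.Ioi z ∩ T) := measureReal_nonneg
  have hTpos : 0 < (gaussianReal m v).real T := by
    rw [← measureReal_Iic_add_Ioi _ z]; linarith
  have hK := Real.exp_pos (k + m / v * z)
  obtain ⟨hw1, hw2⟩ := hw (m / v)
  rw [truncCDF_eq_div hσ hσv, le_div_iff₀ hTpos, div_le_iff₀ hTpos,
    ← measureReal_Iic_add_Ioi _ z T, hA, hB, ← div_le_iff₀' hv', ← le_div_iff₀' hv', ← hw1, ← hw2]
  refine ⟨⟨fun h => le_of_mul_le_mul_left (by linarith) hK, fun h => ?_⟩,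
    ⟨fun h => le_of_mul_le_mul_left (by linarith) hK, fun h => ?_⟩⟩ <;>
  · have := mul_le_mul_of_nonneg_left h hK.le
    linarith

/-- There is no solution when the truncation set has no mass on one side of the argument. -/
theorem truncCDF_ne {σ : ℝ} (hσ : 0 < σ) (hσv : (v : ℝ) = σ ^ 2) {z m : ℝ} {T : Set ℝ}
    {α : ℝ} (hα : α ∈ Set.Ioo (0 : ℝ) 1)
    (h : gaussianReal 0 v (Set.Iic z ∩ T) = 0 ∨ gaussianReal 0 v (Set.Ioi z ∩ T) = 0) :
    truncCDF z m σ T ≠ 1 - α := by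
  have hv := ne_zero_of_coe_eq_sq hσ hσv
  have hac := gaussianReal_absolutelyContinuous_gaussianReal hv m 0
  rw [truncCDF_eq_div hσ hσv]
  rcases h with h | h
  · rw [measureReal_def, hac h]
    simpa using (sub_pos.2 hα.2).ne
  · have hB : (gaussianReal m v).real (Set.Ioi z ∩ T) = 0 := by rw [measureReal_def, hac h]; simp
    have := measureReal_Iic_add_Ioi (gaussianReal m v) z T
    rw [hB, add_zero] at this
    rw [this]
    rcases eq_or_ne ((gaussianReal m v).real T) 0 with h0 | h0
    -- Here the quotient is `0 / 0 = 0`, still different from `1 - α`.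
    · rw [h0]; simpa using (sub_pos.2 hα.2).ne
    · rw [div_self h0]; linarith [hα.1]

/-- One-sided tests of a normal mean are uniformly most powerful above the null value. -/
theorem gaussianReal_le_of_le (hv : v ≠ 0) {m m' : ℝ} (hm : m ≤ m') {T Q C : Set ℝ}
    (hQ : MeasurableSet Q) (hC : MeasurableSet C) (hQT : Q ⊆ T)
    (hsep : ∀ x ∈ T \ C, ∀ y ∈ C, x ≤ y) (hQC : gaussianReal m v Q = gaussianReal m v C) :
    gaussianReal m' v Q ≤ gaussianReal m' v C := by
  obtain ⟨k, hk⟩ := gaussianReal_eq_withDensity hv m m'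
  have hg : Monotone fun x => ENNReal.ofReal (Real.exp ((m' - m) / v * x - k)) := fun x y hxy => by
    have : 0 ≤ (m' - m) / v := div_nonneg (sub_nonneg.2 hm) v.2
    dsimp only; gcongr
  obtain ⟨c, hc, hc'⟩ := exists_forall_le_forall_ge_of_monotone hg (X := Q \ C) (Y := C \ Q)
    fun x hx y hy => hsep x ⟨hQT hx.1, hx.2⟩ y hy.1
  rw [hk]
  exact withDensity_le_withDensity_of_threshold hQ hC hQC c hc hc'

/-- One-sided tests of a normal mean are uniformly least powerful below the null value. -/
theorem gaussianReal_ge_of_ge (hv : v ≠ 0) {m m' : ℝ} (hm : m' ≤ m) {T Q C : Set ℝ}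
    (hQ : MeasurableSet Q) (hC : MeasurableSet C) (hQT : Q ⊆ T)
    (hsep : ∀ x ∈ T \ C, ∀ y ∈ C, x ≤ y) (hQC : gaussianReal m v Q = gaussianReal m v C) :
    gaussianReal m' v C ≤ gaussianReal m' v Q := by
  obtain ⟨k, hk⟩ := gaussianReal_eq_withDensity hv m m'
  have hg : Antitone fun x => ENNReal.ofReal (Real.exp ((m' - m) / v * x - k)) := fun x y hxy => by
    have : (m' - m) / v ≤ 0 := div_nonpos_of_nonpos_of_nonneg (sub_nonpos.2 hm) v.2
    exact ENNReal.ofReal_le_ofReal (Real.exp_le_exp.2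
      (sub_le_sub_right (mul_le_mul_of_nonpos_left hxy this) _))
  obtain ⟨c, hc, hc'⟩ := exists_forall_le_forall_ge_of_antitone hg (X := Q \ C) (Y := C \ Q)
    fun x hx y hy => hsep x ⟨hQT hx.1, hx.2⟩ y hy.1
  rw [hk]
  exact withDensity_le_withDensity_of_threshold hC hQ hQC.symm c hc' hc

end TruncatedNormal

/-! ### Concentration around the target and quasiconvex loss -/

section Loss

theorem measurable_of_quasiconvexOn {f : ℝ → ℝ} (hf : QuasiconvexOn ℝ Set.univ f) :
    Measurable f :=
  measurable_of_Iic fun c => by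
    have hset : f ⁻¹' Set.Iic c = {x | x ∈ Set.univ ∧ f x ≤ c} := by ext x; simp
    rw [hset]
    exact (hf c).ordConnected.measurableSet

/-- Measures `ν₁` that are more concentrated at `x₀` than `ν₂` in terms of half-lines give at most
as much mass to the complement of an interval around `x₀`. -/
theorem measure_compl_le_of_ordConnected {ν₁ ν₂ : Measure ℝ} [IsProbabilityMeasure ν₁]
    [IsProbabilityMeasure ν₂] {x₀ : ℝ} (hl : ∀ m ≤ x₀, ν₁ (Set.Iio m) ≤ ν₂ (Set.Iio m))
    (hr : ∀ m ≥ x₀, ν₁ (Set.Ici m) ≤ ν₂ (Set.Ici m)) {I : Set ℝ} (hI : I.OrdConnected)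
    (hx : x₀ ∈ I) : ν₁ Iᶜ ≤ ν₂ Iᶜ := by
  have hlower : ν₁ (Iᶜ ∩ Set.Iio x₀) ≤ ν₂ (Iᶜ ∩ Set.Iio x₀) := by
    set W := Iᶜ ∩ Set.Iio x₀ with hW
    have hdown : ∀ {x y}, y ∈ W → x ≤ y → x ∈ W := fun {x y} hy hxy =>
      ⟨fun hxI => hy.1 (hI.out hxI hx ⟨hxy, (hy.2 : y < x₀).le⟩), lt_of_le_of_lt hxy hy.2⟩
    rcases W.eq_empty_or_nonempty with h0 | hne
    · simp [h0]
    have hbdd : BddAbove W := ⟨x₀, fun y hy => (hy.2 : y < x₀).le⟩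
    set a := sSup W with ha
    have hax : a ≤ x₀ := csSup_le hne fun y hy => (hy.2 : y < x₀).le
    have hIio : Set.Iio a ⊆ W := fun x hxa => by
      obtain ⟨y, hy, hxy⟩ := exists_lt_of_lt_csSup hne hxa
      exact hdown hy hxy.le
    -- The hypothesis concerns open lower half-lines; a closed one is reached from above, through
    -- points still below `x₀`.
    by_cases haW : a ∈ W
    · have hWeq : W = Set.Iic a :=
        Set.Subset.antisymm (fun y hy => le_csSup hbdd hy) fun y hy => hdown haW hy
      obtain ⟨w, hw, hwm, hwt⟩ := exists_seq_strictAnti_tendsto' (Set.mem_Iio.1 haW.2)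
      have hinter : Set.Iic a = ⋂ n, Set.Iio (w n) := by
        ext x
        simp only [Set.mem_Iic, Set.mem_iInter, Set.mem_Iio]
        exact ⟨fun h n => h.trans_lt (hwm n).1, fun h => ge_of_tendsto' hwt fun n => (h n).le⟩
      rw [hWeq]
      conv_rhs => rw [hinter]
      rw [Antitone.measure_iInter (fun i j hij => Set.Iio_subset_Iio (hw.antitone hij))
        (fun _ => measurableSet_Iio.nullMeasurableSet) ⟨0, measure_ne_top _ _⟩]
      exact le_iInf fun n => (measure_mono fun y hy => lt_of_le_of_lt hy (hwm n).1).trans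
        (hl _ (hwm n).2.le)
    · have hWeq : W = Set.Iio a := Set.Subset.antisymm
        (fun y hy => lt_of_le_of_ne (le_csSup hbdd hy) (ne_of_mem_of_not_mem hy haW)) hIio
      rw [hWeq]; exact hl a hax
  have hupper : ν₁ (Iᶜ ∩ Set.Ioi x₀) ≤ ν₂ (Iᶜ ∩ Set.Ioi x₀) := by
    set W := Iᶜ ∩ Set.Ioi x₀ with hW
    have hup : ∀ {x y}, y ∈ W → y ≤ x → x ∈ W := fun {x y} hy hxy =>
      ⟨fun hxI => hy.1 (hI.out hx hxI ⟨(hy.2 : x₀ < y).le, hxy⟩), lt_of_lt_of_le hy.2 hxy⟩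
    rcases W.eq_empty_or_nonempty with h0 | hne
    · simp [h0]
    have hbdd : BddBelow W := ⟨x₀, fun y hy => (hy.2 : x₀ < y).le⟩
    set a := sInf W with ha
    have hax : x₀ ≤ a := le_csInf hne fun y hy => (hy.2 : x₀ < y).le
    have hIoi : Set.Ioi a ⊆ W := fun x hxa => by
      obtain ⟨y, hy, hxy⟩ := exists_lt_of_csInf_lt hne hxa
      exact hup hy hxy.le
    by_cases haW : a ∈ W
    · have hWeq : W = Set.Ici a :=
        Set.Subset.antisymm (fun y hy => csInf_le hbdd hy) fun y hy => hup haW hy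
      rw [hWeq]; exact hr a hax
    · have hWeq : W = Set.Ioi a := Set.Subset.antisymm
        (fun y hy => lt_of_le_of_ne (csInf_le hbdd hy) (ne_of_mem_of_not_mem hy haW).symm) hIoi
      obtain ⟨w, hw, hwm, hwt⟩ := exists_seq_strictAnti_tendsto a
      rw [hWeq]
      conv_lhs => rw [← iUnion_Ici_eq_Ioi_of_lt_of_tendsto hwm hwt]
      rw [Monotone.measure_iUnion fun i j hij => Set.Ici_subset_Ici.2 (hw.antitone hij)]
      exact iSup_le fun n => (hr _ (hax.trans (hwm n).le)).trans
        (measure_mono fun y hy => lt_of_lt_of_le (hwm n) hy)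
  have hsplit : Iᶜ = (Iᶜ ∩ Set.Iio x₀) ∪ (Iᶜ ∩ Set.Ioi x₀) := by
    ext y
    simp only [Set.mem_union, Set.mem_inter_iff, Set.mem_compl_iff, Set.mem_Iio, Set.mem_Ioi]
    constructor
    · intro hy
      rcases lt_trichotomy y x₀ with h | h | h
      · exact Or.inl ⟨hy, h⟩
      · exact absurd (h ▸ hx) hy
      · exact Or.inr ⟨hy, h⟩
    · rintro (h | h) <;> exact h.1
  have hmeas : MeasurableSet (Iᶜ ∩ Set.Ioi x₀) := hI.measurableSet.compl.inter measurableSet_Ioi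
  have hdisj : Disjoint (Iᶜ ∩ Set.Iio x₀) (Iᶜ ∩ Set.Ioi x₀) :=
    Set.disjoint_left.2 fun y h h' => lt_asymm (Set.mem_Iio.1 h.2) (Set.mem_Ioi.1 h'.2)
  rw [hsplit, measure_union hdisj hmeas, measure_union hdisj hmeas]
  exact add_le_add hlower hupper

theorem lintegral_ofReal_eq_lintegral_meas_lt {Ω : Type*} [MeasurableSpace Ω] (P : Measure Ω)
    {g : Ω → ℝ} (hg : Measurable g) :
    ∫⁻ x, ENNReal.ofReal (g x) ∂P = ∫⁻ t in Set.Ioi (0 : ℝ), P {x | t < g x} := by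
  have hmax : ∀ x, ENNReal.ofReal (g x) = ENNReal.ofReal (max (g x) 0) := fun x => by
    rcases le_total 0 (g x) with h | h
    · rw [max_eq_left h]
    · rw [max_eq_right h, ENNReal.ofReal_of_nonpos h, ENNReal.ofReal_zero]
  simp_rw [hmax]
  rw [lintegral_eq_lintegral_meas_lt P (f := fun x => max (g x) 0)
    (Filter.Eventually.of_forall fun x => le_max_right _ _)
    (hg.max measurable_const).aemeasurable]
  refine setLIntegral_congr_fun measurableSet_Ioi fun t ht => ?_
  have ht' : ¬ t < 0 := not_lt.2 (le_of_lt ht)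
  simp [ht']

/-- A more concentrated estimator has the smaller expected quasiconvex loss. -/
theorem extExpect_le_extExpect_of_concentrated {Ω : Type*} [MeasurableSpace Ω] {P : Measure Ω}
    [IsProbabilityMeasure P] {X Y : Ω → ℝ} (hX : Measurable X) (hY : Measurable Y) {x₀ : ℝ}
    (hl : ∀ m ≤ x₀, P {x | m ≤ Y x} ≤ P {x | m ≤ X x})
    (hr : ∀ m ≥ x₀, P {x | m ≤ X x} ≤ P {x | m ≤ Y x}) {f : ℝ → ℝ}
    (hf : QuasiconvexOn ℝ Set.univ f) (hmin : ∀ d, f x₀ ≤ f d) :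
    extExpect P (fun x => f (X x)) ≤ extExpect P (fun x => f (Y x)) := by
  have hfm := measurable_of_quasiconvexOn hf
  have := Measure.isProbabilityMeasure_map (μ := P) hX.aemeasurable
  have := Measure.isProbabilityMeasure_map (μ := P) hY.aemeasurable
  have hIci : ∀ {Z : Ω → ℝ}, Measurable Z → ∀ m, (P.map Z) (Set.Ici m) = P {x | m ≤ Z x} :=
    fun hZ m => Measure.map_apply hZ measurableSet_Ici
  have hl' : ∀ m ≤ x₀, (P.map X) (Set.Iio m) ≤ (P.map Y) (Set.Iio m) := fun m hm => by
    rw [← Set.compl_Ici, prob_compl_eq_one_sub measurableSet_Ici,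
      prob_compl_eq_one_sub measurableSet_Ici, hIci hX, hIci hY]
    exact tsub_le_tsub_left (hl m hm) _
  have hr' : ∀ m ≥ x₀, (P.map X) (Set.Ici m) ≤ (P.map Y) (Set.Ici m) := fun m hm => by
    rw [hIci hX, hIci hY]; exact hr m hm
  have key : ∀ I : Set ℝ, I.OrdConnected → (I.Nonempty → x₀ ∈ I) →
      P (X ⁻¹' Iᶜ) ≤ P (Y ⁻¹' Iᶜ) := fun I hI hne => by
    rcases I.eq_empty_or_nonempty with h0 | h0
    · simp [h0]
    · rw [← Measure.map_apply hX hI.measurableSet.compl, ← Measure.map_apply hY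
        hI.measurableSet.compl]
      exact measure_compl_le_of_ordConnected hl' hr' hI (hne h0)
  unfold extExpect
  -- The positive part is compared on complements of sublevel sets and the negative part, with the
  -- reverse inequality, on strict sublevel sets.
  refine EReal.sub_le_sub ?_ ?_
  · rw [EReal.coe_ennreal_le_coe_ennreal_iff,
      lintegral_ofReal_eq_lintegral_meas_lt P (g := fun x => f (X x)) (hfm.comp hX),
      lintegral_ofReal_eq_lintegral_meas_lt P (g := fun x => f (Y x)) (hfm.comp hY)]
    refine lintegral_mono fun t => ?_
    have hconv : Set.OrdConnected {d | f d ≤ t} := by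
      have hset : {d | f d ≤ t} = {d | d ∈ Set.univ ∧ f d ≤ t} := by ext d; simp
      rw [hset]; exact (hf t).ordConnected
    have := key {d | f d ≤ t} hconv fun ⟨d, hd⟩ => (hmin d).trans hd
    simpa [Set.preimage, Set.compl_ofPred] using this
  · rw [EReal.coe_ennreal_le_coe_ennreal_iff,
      lintegral_ofReal_eq_lintegral_meas_lt P (g := fun x => -f (X x)) (hfm.comp hX).neg,
      lintegral_ofReal_eq_lintegral_meas_lt P (g := fun x => -f (Y x)) (hfm.comp hY).neg]
    refine lintegral_mono fun t => ?_
    have hconv : Set.OrdConnected {d | f d < -t} := by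
      have hset : {d | f d < -t} = {d | d ∈ Set.univ ∧ f d < -t} := by ext d; simp
      rw [hset]; exact (hf.convex_lt (-t)).ordConnected
    have hm := hconv.measurableSet
    have := key {d | f d < -t} hconv fun ⟨d, hd⟩ => (hmin d).trans_lt hd
    have hset : ∀ Z : Ω → ℝ, {x | t < -f (Z x)} = (Z ⁻¹' {d | f d < -t}ᶜ)ᶜ := fun Z => by
      ext x; simp [lt_neg]
    simp only [hset]
    rw [prob_compl_eq_one_sub (hX hm.compl), prob_compl_eq_one_sub (hY hm.compl)]
    exact tsub_le_tsub_left this _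

end Loss

/-! ### The multivariate normal model and the estimator -/

section Assembly

theorem lPost_ne_zero {ι κ : Type*} (post : κ ↪ ι) {l : κ → ℝ} (hl : l ≠ 0) : lPost post l ≠ 0 := by
  intro h
  refine hl (funext fun k => ?_)
  have := congrFun h (post k)
  rwa [lPost, post.injective.extend_apply] at this

theorem postVar_pos {ι κ : Type*} [Fintype ι] {S : Matrix ι ι ℝ} (hS : S.PosDef) (post : κ ↪ ι)
    {l : κ → ℝ} (hl : l ≠ 0) :
    0 < postVar S post l := by
  have := hS.dotProduct_mulVec_pos (lPost_ne_zero post hl)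
  rwa [star_trivial] at this

/-- `postVar` as a nonnegative real number. -/
noncomputable def postNNVar {ι κ : Type*} [Fintype ι] (S : Matrix ι ι ℝ)
    (post : κ ↪ ι) (l : κ → ℝ) : NNReal :=
  (postVar S post l).toNNReal

theorem coe_postNNVar {ι κ : Type*} [Fintype ι] {S : Matrix ι ι ℝ} (hS : S.PosDef) (post : κ ↪ ι)
    {l : κ → ℝ} (hl : l ≠ 0) :
    (postNNVar S post l : ℝ) = postVar S post l :=
  Real.coe_toNNReal _ (postVar_pos hS post hl).le

theorem postNNVar_ne_zero {ι κ : Type*} [Fintype ι] {S : Matrix ι ι ℝ} (hS : S.PosDef)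
    (post : κ ↪ ι) {l : κ → ℝ} (hl : l ≠ 0) : postNNVar S post l ≠ 0 := by
  have := postVar_pos hS post hl
  rw [← coe_postNNVar hS post hl] at this
  exact_mod_cast this.ne'

theorem measurable_postLin {ι κ : Type*} [Fintype κ] {post : κ ↪ ι} {l : κ → ℝ} :
    Measurable (postLin (ι := ι) post l) := by
  unfold postLin; fun_prop

variable {ι κ : Type*} [Fintype ι]

/-- `lPost` as a vector of the Euclidean space. -/
noncomputable def postVec (post : κ ↪ ι) (l : κ → ℝ) : EuclideanSpace ℝ ι :=
  WithLp.toLp 2 (lPost post l)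

theorem coe_postNNVar_eq_sq {S : Matrix ι ι ℝ} (hS : S.PosDef) {post : κ ↪ ι} {l : κ → ℝ}
    (hl : l ≠ 0) :
    (postNNVar S post l : ℝ) = Real.sqrt (postVar S post l) ^ 2 := by
  rw [coe_postNNVar hS post hl, Real.sq_sqrt (postVar_pos hS post hl).le]

section Gaussian

variable [DecidableEq ι]

theorem isGaussianLocation_multivariateGaussian {S : Matrix ι ι ℝ} (hS : S.PosDef) :
    IsGaussianLocation (toEuclideanCLM (𝕜 := ℝ) S) (fun β => multivariateGaussian β S) := by
  have hsymm : ∀ x y : EuclideanSpace ℝ ι,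
      ⟪x, toEuclideanCLM (𝕜 := ℝ) S y⟫ = ⟪toEuclideanCLM (𝕜 := ℝ) S x, y⟫ := fun x y => by
    have hT : Sᵀ = S := by simpa [IsHermitian, conjTranspose_eq_transpose_of_trivial] using hS.1
    rw [real_inner_comm y (toEuclideanCLM (𝕜 := ℝ) S x), inner_toEuclideanCLM,
      inner_toEuclideanCLM, dotProduct_mulVec,
      ← mulVec_transpose, hT, dotProduct_comm]
  have hlaw : ∀ β t : EuclideanSpace ℝ ι,
      (multivariateGaussian β S).map (fun x => ⟪t, x⟫) =
        gaussianReal ⟪t, β⟫ ⟪t, toEuclideanCLM (𝕜 := ℝ) S t⟫.toNNReal := fun β t => by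
    have h1 := IsGaussian.map_eq_gaussianReal (μ := multivariateGaussian β S) (innerSL ℝ t)
    have h2 : (multivariateGaussian β S)[innerSL ℝ t] = ⟪t, β⟫ := by
      rw [(innerSL ℝ t).integral_comp_id_comm IsGaussian.integrable_id,
        integral_id_multivariateGaussian]; rfl
    have h3 : Var[innerSL ℝ t; multivariateGaussian β S] =
        ⟪t, toEuclideanCLM (𝕜 := ℝ) S t⟫ := by
      rw [inner_toEuclideanCLM, ← covarianceBilin_multivariateGaussian (μ := β) hS.posSemidef,
        covarianceBilin_self IsGaussian.memLp_two_id]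
      rfl
    rw [h2, h3] at h1
    exact h1
  have hexp : ∀ β t : EuclideanSpace ℝ ι, (fun x => Real.exp ⟪t, x⟫) =
      (fun y : ℝ => Real.exp (1 * y)) ∘ fun x : EuclideanSpace ℝ ι => ⟪t, x⟫ := fun β t => by
    ext x; simp
  refine ⟨fun β => inferInstance, hsymm, fun β t => ?_, fun β t => ?_⟩
  · rw [hexp β t, ← integrable_map_measure (by fun_prop) (by fun_prop), hlaw]
    exact integrable_exp_mul_gaussianReal 1
  · have := mgf_gaussianReal (hlaw β t) 1
    simp only [mgf, one_mul, mul_one, one_pow] at this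
    rw [this, Real.coe_toNNReal _ (by
      rw [inner_toEuclideanCLM]
      simpa using hS.posSemidef.dotProduct_mulVec_nonneg (WithLp.ofLp t))]

theorem surjective_toEuclideanCLM {S : Matrix ι ι ℝ} (hS : S.PosDef) :
    Function.Surjective (toEuclideanCLM (𝕜 := ℝ) S) := fun y => by
  refine ⟨toEuclideanCLM (𝕜 := ℝ) S⁻¹ y, ?_⟩
  rw [← mul_apply_eq_comp, ← map_mul,
    mul_nonsing_inv _ ((isUnit_iff_isUnit_det _).1 hS.isUnit), map_one]
  rfl

theorem inner_postVec_toEuclideanCLM {S : Matrix ι ι ℝ} (hS : S.PosDef) (post : κ ↪ ι)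
    {l : κ → ℝ} (hl : l ≠ 0) :
    ⟪postVec post l, toEuclideanCLM (𝕜 := ℝ) S (postVec post l)⟫ = postNNVar S post l := by
  rw [inner_toEuclideanCLM, coe_postNNVar hS post hl]; rfl

theorem postCoef_eq_smul {S : Matrix ι ι ℝ} (hS : S.PosDef) (post : κ ↪ ι)
    {l : κ → ℝ} (hl : l ≠ 0) :
    postCoef S post l =
      (postNNVar S post l : ℝ)⁻¹ • toEuclideanCLM (𝕜 := ℝ) S (postVec post l) := by
  rw [coe_postNNVar hS post hl]; rfl

theorem inner_postVec_postCoef {S : Matrix ι ι ℝ} (hS : S.PosDef) (post : κ ↪ ι)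
    {l : κ → ℝ} (hl : l ≠ 0) : ⟪postVec post l, postCoef S post l⟫ = 1 := by
  have : (postNNVar S post l : ℝ) ≠ 0 := by exact_mod_cast postNNVar_ne_zero hS post hl
  rw [postCoef_eq_smul hS post hl, inner_smul_right, inner_postVec_toEuclideanCLM hS post hl]
  field_simp

end Gaussian

variable [Fintype κ]

theorem postLin_eq_inner (post : κ ↪ ι) (l : κ → ℝ) (b : EuclideanSpace ℝ ι) :
    postLin post l b = ⟪postVec post l, b⟫ := by
  simp only [postLin, postVec, PiLp.inner_apply, RCLike.inner_apply, conj_trivial]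
  refine Fintype.sum_of_injective post post.injective _ _ (fun i hi => ?_) fun k => ?_
  · rw [lPost, Function.extend_apply' _ _ _ fun ⟨k, hk⟩ => hi ⟨k, hk⟩]; simp
  · rw [lPost, post.injective.extend_apply, mul_comm]

theorem postResid_eq_resid (S : Matrix ι ι ℝ) (post : κ ↪ ι) (l : κ → ℝ)
    (b : EuclideanSpace ℝ ι) :
    postResid S post l b = resid (postVec post l) (postCoef S post l) b := by
  rw [postResid, resid, postLin_eq_inner]

/-- At the realization `b`, the truncation set has mass on both sides of the linear statistic. -/
def HasMassOnBothSides (S : Matrix ι ι ℝ) (post : κ ↪ ι) (l : κ → ℝ)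
    (B : Set (EuclideanSpace ℝ ι)) (b : EuclideanSpace ℝ ι) : Prop :=
  gaussianReal 0 (postNNVar S post l) (Set.Iic (postLin post l b) ∩ postTrunc S post l B b) ≠ 0 ∧
    gaussianReal 0 (postNNVar S post l) (Set.Ioi (postLin post l b) ∩ postTrunc S post l B b) ≠ 0

variable {S : Matrix ι ι ℝ} {post : κ ↪ ι} {l : κ → ℝ} {B : Set (EuclideanSpace ℝ ι)} {α : ℝ}

theorem measurable_postResid : Measurable (postResid S post l) := by
  have := measurable_postLin (post := post) (l := l)
  unfold postResid; fun_prop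

theorem measurableSet_postTrunc (hB : MeasurableSet B) (b : EuclideanSpace ℝ ι) :
    MeasurableSet (postTrunc S post l B b) :=
  (by fun_prop : Measurable fun z : ℝ => postResid S post l b + z • postCoef S post l) hB

theorem measurable_gaussianReal_inter_postTrunc (hB : MeasurableSet B) (m : ℝ) (v : NNReal)
    {s : EuclideanSpace ℝ ι → Set ℝ}
    (hs : MeasurableSet {p : EuclideanSpace ℝ ι × ℝ | p.2 ∈ s p.1}) :
    Measurable fun b => gaussianReal m v (s b ∩ postTrunc S post l B b) := by
  have hr := measurable_postResid (S := S) (post := post) (l := l)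
  exact measurable_measure_prodMk_left (ν := gaussianReal m v) (hs.inter
    ((by fun_prop : Measurable fun p : EuclideanSpace ℝ ι × ℝ =>
      postResid S post l p.1 + p.2 • postCoef S post l) hB))

theorem measurable_gaussianReal_Iic (hB : MeasurableSet B) (m : ℝ) (v : NNReal) :
    Measurable fun b => gaussianReal m v (Set.Iic (postLin post l b) ∩ postTrunc S post l B b) :=
  measurable_gaussianReal_inter_postTrunc hB m v
    (measurableSet_le measurable_snd (measurable_postLin.comp measurable_fst))

theorem measurable_gaussianReal_Ioi (hB : MeasurableSet B) (m : ℝ) (v : NNReal) :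
    Measurable fun b => gaussianReal m v (Set.Ioi (postLin post l b) ∩ postTrunc S post l B b) :=
  measurable_gaussianReal_inter_postTrunc hB m v
    (measurableSet_lt (measurable_postLin.comp measurable_fst) measurable_snd)

theorem measurable_gaussianReal_postTrunc (hB : MeasurableSet B) (m : ℝ) (v : NNReal) :
    Measurable fun b => gaussianReal m v (postTrunc S post l B b) := by
  simpa using measurable_gaussianReal_inter_postTrunc (S := S) (post := post) (l := l) hB m v
    (s := fun _ => Set.univ) (by simp)

theorem measurableSet_hasMassOnBothSides (hB : MeasurableSet B) :
    MeasurableSet {b | HasMassOnBothSides S post l B b} :=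
  ((measurable_gaussianReal_Iic hB _ _) (measurableSet_singleton 0)).compl.inter
    ((measurable_gaussianReal_Ioi hB _ _) (measurableSet_singleton 0)).compl

/-- Besides uniqueness, the equivalences translate events about `muStar` into events about the
distribution function at a fixed mean. -/
theorem existsUnique_solvesAt_and_muStar_spec (hS : S.PosDef) (hl : l ≠ 0) (hB : MeasurableSet B)
    (hα : α ∈ Set.Ioo (0 : ℝ) 1) {b : EuclideanSpace ℝ ι} (hb : HasMassOnBothSides S post l B b) :
    (∃! m, SolvesAt S post l B α b m) ∧ ∀ m,
      (1 - α ≤ truncCDF (postLin post l b) m (Real.sqrt (postVar S post l))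
        (postTrunc S post l B b) ↔ m ≤ muStar S post l B α b) ∧
      (truncCDF (postLin post l b) m (Real.sqrt (postVar S post l))
        (postTrunc S post l B b) ≤ 1 - α ↔ muStar S post l B α b ≤ m) := by
  obtain ⟨w, hw⟩ := exists_truncCDF_crossing (Real.sqrt_pos.2 (postVar_pos hS post hl))
    (coe_postNNVar_eq_sq hS hl) (measurableSet_postTrunc hB b) hα hb.1 hb.2
  have hsol : ∀ m, SolvesAt S post l B α b m ↔ m = w := fun m => by
    rw [SolvesAt, le_antisymm_iff, (hw m).1, (hw m).2, and_comm, ← le_antisymm_iff]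
  have hex : ∃ m, SolvesAt S post l B α b m := ⟨w, (hsol w).2 rfl⟩
  have hmu : muStar S post l B α b = w := by
    rw [muStar, dif_pos hex]; exact (hsol _).1 hex.choose_spec
  rw [hmu]
  exact ⟨⟨w, (hsol w).2 rfl, fun m hm => (hsol m).1 hm⟩, hw⟩

/-- Measurability of `muStar` on the whole space needs its value at the exceptional points too. -/
theorem muStar_eq_zero (hS : S.PosDef) (hl : l ≠ 0) (hα : α ∈ Set.Ioo (0 : ℝ) 1)
    {b : EuclideanSpace ℝ ι} (hb : ¬ HasMassOnBothSides S post l B b) :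
    muStar S post l B α b = 0 := by
  rw [muStar, dif_neg]
  rintro ⟨m, hm⟩
  refine truncCDF_ne (Real.sqrt_pos.2 (postVar_pos hS post hl)) (coe_postNNVar_eq_sq hS hl) hα
    ?_ hm
  rwa [HasMassOnBothSides, not_and_or, not_not, not_not] at hb

theorem measurable_muStar (hS : S.PosDef) (hl : l ≠ 0) (hB : MeasurableSet B)
    (hα : α ∈ Set.Ioo (0 : ℝ) 1) : Measurable (muStar S post l B α) := by
  refine measurable_of_Iic fun c => ?_
  have hcdf : Measurable fun b => truncCDF (postLin post l b) c (Real.sqrt (postVar S post l))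
      (postTrunc S post l B b) := by
    simp_rw [truncCDF_eq_div (Real.sqrt_pos.2 (postVar_pos hS post hl))
      (coe_postNNVar_eq_sq hS hl), measureReal_def]
    exact (measurable_gaussianReal_Iic hB _ _).ennreal_toReal.div
      (measurable_gaussianReal_postTrunc hB _ _).ennreal_toReal
  have hD := measurableSet_hasMassOnBothSides (S := S) (post := post) (l := l) hB
  have hset : muStar S post l B α ⁻¹' Set.Iic c =
      ({b | HasMassOnBothSides S post l B b} ∩
        {b | truncCDF (postLin post l b) c (Real.sqrt (postVar S post l))
          (postTrunc S post l B b) ≤ 1 - α}) ∪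
      ({b | HasMassOnBothSides S post l B b}ᶜ ∩ {_b | (0 : ℝ) ≤ c}) := by
    ext b
    by_cases hb : HasMassOnBothSides S post l B b
    · simp [hb, ((existsUnique_solvesAt_and_muStar_spec hS hl hB hα hb).2 c).2]
    · simp [hb, muStar_eq_zero hS hl hα hb]
  rw [hset]
  exact (hD.inter (measurableSet_le hcdf measurable_const)).union
    (hD.compl.inter (MeasurableSet.const _))

theorem measurableSet_section (c r : EuclideanSpace ℝ ι) {M : Set (EuclideanSpace ℝ ι)}
    (hM : MeasurableSet M) : MeasurableSet {z : ℝ | r + z • c ∈ M} :=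
  (by fun_prop : Measurable fun z : ℝ => r + z • c) hM

/-! ### Conditioning on the residual: size and optimality on the fibres -/

section Conditional

variable [DecidableEq ι]

/-- Along the fibre over a residual, the truncation set is a section of `B`. -/
theorem postLin_postTrunc_add_smul (hS : S.PosDef) (hl : l ≠ 0) {r : EuclideanSpace ℝ ι}
    (hr : ⟪postVec post l, r⟫ = 0) (z : ℝ) :
    postLin post l (r + z • postCoef S post l) = z ∧
      postTrunc S post l B (r + z • postCoef S post l) = {t | r + t • postCoef S post l ∈ B} := by
  have huc := inner_postVec_postCoef hS post hl
  constructor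
  · rw [postLin_eq_inner, inner_add_right, inner_smul_right, hr, huc]; ring
  · rw [postTrunc, postResid_eq_resid, resid_add_smul huc hr]

theorem ae_hasMassOnBothSides_add_smul (hS : S.PosDef) (hl : l ≠ 0) {r : EuclideanSpace ℝ ι}
    (hB : MeasurableSet B) (hr : ⟪postVec post l, r⟫ = 0) (m : ℝ) :
    ∀ᵐ z ∂(gaussianReal m (postNNVar S post l)), r + z • postCoef S post l ∈ B →
      HasMassOnBothSides S post l B (r + z • postCoef S post l) := by
  have hv := postNNVar_ne_zero hS post hl
  have := nullSingletonClass_gaussianReal (μ := 0) hv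
  have hT := measurableSet_section (postCoef S post l) r hB
  have hac := gaussianReal_absolutelyContinuous_gaussianReal hv m 0
  -- Normal laws of equal variance share their null sets, so mean zero suffices.
  refine hac.ae_le ((ae_restrict_iff' hT).1 ?_)
  filter_upwards [ae_measure_Iic_pos_and_measure_Ioi_pos ((gaussianReal 0
    (postNNVar S post l)).restrict {z : ℝ | r + z • postCoef S post l ∈ B})] with z hz
  rw [Measure.restrict_apply measurableSet_Iic, Measure.restrict_apply measurableSet_Ioi] at hz
  obtain ⟨h1, h2⟩ := postLin_postTrunc_add_smul (B := B) hS hl hr z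
  rw [HasMassOnBothSides, h1, h2]
  exact ⟨hz.1.ne', hz.2.ne'⟩

/-- On the fibre over a residual, the event that `muStar` exceeds `m` is the one-sided test. -/
theorem gaussianReal_section_muStar (hS : S.PosDef) (hl : l ≠ 0) (hB : MeasurableSet B)
    (hα : α ∈ Set.Ioo (0 : ℝ) 1) {r : EuclideanSpace ℝ ι} (hr : ⟪postVec post l, r⟫ = 0)
    (m m' : ℝ) :
    gaussianReal m' (postNNVar S post l)
        {z | r + z • postCoef S post l ∈ B ∩ {b | m ≤ muStar S post l B α b}} =
      gaussianReal m' (postNNVar S post l) {z | z ∈ {t | r + t • postCoef S post l ∈ B} ∧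
        ENNReal.ofReal (1 - α) *
          gaussianReal m (postNNVar S post l) {t | r + t • postCoef S post l ∈ B} ≤
        gaussianReal m (postNNVar S post l) (Set.Iic z ∩ {t | r + t • postCoef S post l ∈ B})} := by
  refine measure_congr (Filter.eventuallyEq_set.2 ?_)
  have hv := postNNVar_ne_zero hS post hl
  filter_upwards [ae_hasMassOnBothSides_add_smul hS hl hB hr m'] with z hz
  simp only [Set.mem_ofPred_eq, Set.mem_inter_iff]
  refine and_congr_right fun hzB => ?_
  obtain ⟨h1, h2⟩ := postLin_postTrunc_add_smul (B := B) hS hl hr z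
  have hmass := hz hzB
  have hspec := ((existsUnique_solvesAt_and_muStar_spec hS hl hB hα hmass).2 m).1
  rw [HasMassOnBothSides, h1, h2] at hmass
  rw [← hspec, h1, h2, truncCDF_eq_div (Real.sqrt_pos.2 (postVar_pos hS post hl))
    (coe_postNNVar_eq_sq hS hl)]
  have hpos : 0 < (gaussianReal m (postNNVar S post l)).real
      {t | r + t • postCoef S post l ∈ B} := by
    refine ENNReal.toReal_pos (fun h => hmass.1 ?_) (measure_ne_top _ _)
    exact gaussianReal_absolutelyContinuous_gaussianReal hv 0 m
      (measure_mono_null Set.inter_subset_right h)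
  rw [le_div_iff₀ hpos, ← ENNReal.ofReal_le_ofReal_iff measureReal_nonneg,
    ENNReal.ofReal_mul (sub_nonneg.2 hα.2.le), ofReal_measureReal, ofReal_measureReal]

theorem gaussianReal_section_muStar_eq (hS : S.PosDef) (hl : l ≠ 0) (hB : MeasurableSet B)
    (hα : α ∈ Set.Ioo (0 : ℝ) 1) {r : EuclideanSpace ℝ ι} (hr : ⟪postVec post l, r⟫ = 0) (m : ℝ) :
    gaussianReal m (postNNVar S post l)
        {z | r + z • postCoef S post l ∈ B ∩ {b | m ≤ muStar S post l B α b}} =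
      ENNReal.ofReal α *
        gaussianReal m (postNNVar S post l) {z | r + z • postCoef S post l ∈ B} := by
  have := nullSingletonClass_gaussianReal (μ := m) (postNNVar_ne_zero hS post hl)
  rw [gaussianReal_section_muStar hS hl hB hα hr, measure_inter_setOf_le _ hα]

theorem ae_hasMassOnBothSides (hS : S.PosDef) (hl : l ≠ 0) (hB : MeasurableSet B)
    (β : EuclideanSpace ℝ ι) :
    ∀ᵐ b ∂((multivariateGaussian β S).restrict B), HasMassOnBothSides S post l B b := by
  have hG := isGaussianLocation_multivariateGaussian hS
  have hM := hB.inter (measurableSet_hasMassOnBothSides (S := S) (post := post) (l := l) hB).compl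
  rw [ae_restrict_iff' hB, ae_iff]
  have hset : {b | ¬ (b ∈ B → HasMassOnBothSides S post l B b)} =
      B ∩ {b | HasMassOnBothSides S post l B b}ᶜ := by ext b; simp
  rw [hset, hG.measure_eq_lintegral (postNNVar_ne_zero hS post hl)
    (inner_postVec_toEuclideanCLM hS post hl) (postCoef_eq_smul hS post hl) β hM]
  rw [lintegral_eq_zero_iff (measurable_gaussianReal_section _ _ _ hM)]
  filter_upwards [ae_inner_eq_zero_map_resid (inner_postVec_postCoef hS post hl)
    (multivariateGaussian β S)] with r hr
  have := ae_hasMassOnBothSides_add_smul hS hl hB hr ⟪postVec post l, β⟫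
  rw [ae_iff] at this
  simpa using this

theorem multivariateGaussian_muStar_eq (hS : S.PosDef) (hl : l ≠ 0) (hB : MeasurableSet B)
    (hα : α ∈ Set.Ioo (0 : ℝ) 1) (β : EuclideanSpace ℝ ι) :
    multivariateGaussian β S (B ∩ {b | postLin post l β ≤ muStar S post l B α b}) =
      ENNReal.ofReal α * multivariateGaussian β S B := by
  have hG := isGaussianLocation_multivariateGaussian hS
  have hM : MeasurableSet (B ∩ {b | postLin post l β ≤ muStar S post l B α b}) :=
    hB.inter (measurableSet_le measurable_const (measurable_muStar hS hl hB hα))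
  rw [hG.measure_eq_lintegral (postNNVar_ne_zero hS post hl)
    (inner_postVec_toEuclideanCLM hS post hl) (postCoef_eq_smul hS post hl) β hM,
    hG.measure_eq_lintegral (postNNVar_ne_zero hS post hl)
    (inner_postVec_toEuclideanCLM hS post hl) (postCoef_eq_smul hS post hl) β hB,
    ← lintegral_const_mul _ (measurable_gaussianReal_section _ _ _ hB)]
  refine lintegral_congr_ae ?_
  filter_upwards [ae_inner_eq_zero_map_resid (inner_postVec_postCoef hS post hl)
    (multivariateGaussian β S)] with r hr
  rw [postLin_eq_inner]
  exact gaussianReal_section_muStar_eq hS hl hB hα hr _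

/-- Clearing the positive denominator gives the linear form of unbiasedness that the completeness
argument takes as hypothesis. -/
theorem condLaw_real_eq_iff (hS : S.PosDef) (hB : MeasurableSet B) (hBpos : 0 < volume B)
    (hα : 0 ≤ α) (β : EuclideanSpace ℝ ι) (M : Set (EuclideanSpace ℝ ι)) :
    (condLaw S B β).real M = α ↔
      multivariateGaussian β S (B ∩ M) = ENNReal.ofReal α * multivariateGaussian β S B := by
  have hpos := ((isGaussianLocation_multivariateGaussian hS).measure_pos
    (surjective_toEuclideanCLM hS) hB hBpos β).ne'
  have hfin := measure_ne_top (multivariateGaussian β S) B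
  rw [condLaw, measureReal_def, cond_apply hB]
  have hne : (multivariateGaussian β S B)⁻¹ * multivariateGaussian β S (B ∩ M) ≠ ∞ :=
    ENNReal.mul_ne_top (ENNReal.inv_ne_top.2 hpos) (measure_ne_top _ _)
  rw [← ENNReal.toReal_ofReal hα, ENNReal.toReal_eq_toReal_iff' hne ENNReal.ofReal_ne_top,
    ENNReal.toReal_ofReal hα, mul_comm, ← div_eq_mul_inv, eq_comm,
    ENNReal.eq_div_iff hpos hfin, eq_comm, mul_comm]

theorem isQuantileCondUnbiased_muStar (hS : S.PosDef) (hl : l ≠ 0) (hB : MeasurableSet B)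
    (hBpos : 0 < volume B) (hα : α ∈ Set.Ioo (0 : ℝ) 1) :
    IsQuantileCondUnbiased S post l B α (muStar S post l B α) where
  measurable := measurable_muStar hS hl hB hα
  prob_eq β := (condLaw_real_eq_iff hS hB hBpos hα.1.le β _).2
    (multivariateGaussian_muStar_eq hS hl hB hα β)

/-- On almost every fibre, the event that an unbiased estimator exceeds `m` and the corresponding
event for `muStar` have the same probability at `m`. -/
theorem ae_gaussianReal_section_eq (hS : S.PosDef) (hl : l ≠ 0) (hB : MeasurableSet B)
    (hBpos : 0 < volume B) (hα : α ∈ Set.Ioo (0 : ℝ) 1) {q : EuclideanSpace ℝ ι → ℝ}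
    (hq : IsQuantileCondUnbiased S post l B α q) (m : ℝ) (β : EuclideanSpace ℝ ι) :
    ∀ᵐ r ∂((multivariateGaussian β S).map (resid (postVec post l) (postCoef S post l))),
      gaussianReal m (postNNVar S post l)
          {z | r + z • postCoef S post l ∈ B ∩ {b | m ≤ q b}} =
        ENNReal.ofReal α *
          gaussianReal m (postNNVar S post l) {z | r + z • postCoef S post l ∈ B} := by
  refine (isGaussianLocation_multivariateGaussian hS).ae_measure_section_eq
    (surjective_toEuclideanCLM hS) (postNNVar_ne_zero hS post hl)
    (inner_postVec_toEuclideanCLM hS post hl) (postCoef_eq_smul hS post hl)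
    (hB.inter (measurableSet_le measurable_const hq.measurable)) hB ENNReal.ofReal_ne_top
    (fun β' hβ' => ?_) β
  have := (condLaw_real_eq_iff hS hB hBpos hα.1.le β' _).1 (hq.prob_eq β')
  rwa [postLin_eq_inner, hβ'] at this

/-- Monotonicity of `z ↦ ν (Iic z ∩ T)` makes the rejection region an upper part of `T`, the shape
that Neyman–Pearson requires. -/
theorem separated_one_sided_test (ν : Measure ℝ) (T : Set ℝ) (p : ℝ≥0∞) :
    ∀ x ∈ T \ {z | z ∈ T ∧ p ≤ ν (Set.Iic z ∩ T)}, ∀ y ∈ {z | z ∈ T ∧ p ≤ ν (Set.Iic z ∩ T)},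
      x ≤ y := by
  intro x hx y hy
  by_contra hxy
  exact hx.2 ⟨hx.1, hy.2.trans (measure_mono (Set.inter_subset_inter_left _
    (Set.Iic_subset_Iic.2 (not_le.1 hxy).le)))⟩

theorem measurableSet_one_sided_test (ν : Measure ℝ) {T : Set ℝ} (hT : MeasurableSet T)
    (p : ℝ≥0∞) : MeasurableSet {z | z ∈ T ∧ p ≤ ν (Set.Iic z ∩ T)} := by
  have := hT.inter (measurableSet_setOf_le_measure_Iic (ν.restrict T) p)
  simp only [Measure.restrict_apply measurableSet_Iic] at this
  exact this

/-- `muStar` exceeds values below the target at least as often as any unbiased estimator. -/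
theorem multivariateGaussian_le_muStar_of_le (hS : S.PosDef) (hl : l ≠ 0) (hB : MeasurableSet B)
    (hBpos : 0 < volume B) (hα : α ∈ Set.Ioo (0 : ℝ) 1) {q : EuclideanSpace ℝ ι → ℝ}
    (hq : IsQuantileCondUnbiased S post l B α q) {m : ℝ} {β : EuclideanSpace ℝ ι}
    (hm : m ≤ postLin post l β) :
    multivariateGaussian β S (B ∩ {b | m ≤ q b}) ≤
      multivariateGaussian β S (B ∩ {b | m ≤ muStar S post l B α b}) := by
  have hG := isGaussianLocation_multivariateGaussian hS
  have hv := postNNVar_ne_zero hS post hl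
  have hu := inner_postVec_toEuclideanCLM hS post hl
  have hc := postCoef_eq_smul hS post hl
  have hQ := hB.inter (measurableSet_le (measurable_const (a := m)) hq.measurable)
  have hC := hB.inter (measurableSet_le (measurable_const (a := m))
    (measurable_muStar (post := post) hS hl hB hα))
  rw [hG.measure_eq_lintegral hv hu hc β hQ, hG.measure_eq_lintegral hv hu hc β hC]
  refine lintegral_mono_ae ?_
  filter_upwards [ae_inner_eq_zero_map_resid (inner_postVec_postCoef hS post hl)
    (multivariateGaussian β S), ae_gaussianReal_section_eq hS hl hB hBpos hα hq m β] with r hr hrq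
  -- Both events have size `α` on the fibre under mean `m`; they are then compared under the true
  -- mean.
  rw [← gaussianReal_section_muStar_eq hS hl hB hα hr m,
    gaussianReal_section_muStar hS hl hB hα hr] at hrq
  rw [gaussianReal_section_muStar hS hl hB hα hr]
  rw [postLin_eq_inner] at hm
  exact gaussianReal_le_of_le hv hm (measurableSet_section _ r hQ)
    (measurableSet_one_sided_test _ (measurableSet_section _ r hB) _) (fun z hz => hz.1)
    (separated_one_sided_test _ _ _) hrq

/-- `muStar` exceeds values above the target at most as often as any unbiased estimator. -/
theorem multivariateGaussian_muStar_le_of_ge (hS : S.PosDef) (hl : l ≠ 0) (hB : MeasurableSet B)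
    (hBpos : 0 < volume B) (hα : α ∈ Set.Ioo (0 : ℝ) 1) {q : EuclideanSpace ℝ ι → ℝ}
    (hq : IsQuantileCondUnbiased S post l B α q) {m : ℝ} {β : EuclideanSpace ℝ ι}
    (hm : postLin post l β ≤ m) :
    multivariateGaussian β S (B ∩ {b | m ≤ muStar S post l B α b}) ≤
      multivariateGaussian β S (B ∩ {b | m ≤ q b}) := by
  have hG := isGaussianLocation_multivariateGaussian hS
  have hv := postNNVar_ne_zero hS post hl
  have hu := inner_postVec_toEuclideanCLM hS post hl
  have hc := postCoef_eq_smul hS post hl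
  have hQ := hB.inter (measurableSet_le (measurable_const (a := m)) hq.measurable)
  have hC := hB.inter (measurableSet_le (measurable_const (a := m))
    (measurable_muStar (post := post) hS hl hB hα))
  rw [hG.measure_eq_lintegral hv hu hc β hQ, hG.measure_eq_lintegral hv hu hc β hC]
  refine lintegral_mono_ae ?_
  filter_upwards [ae_inner_eq_zero_map_resid (inner_postVec_postCoef hS post hl)
    (multivariateGaussian β S), ae_gaussianReal_section_eq hS hl hB hBpos hα hq m β] with r hr hrq
  rw [← gaussianReal_section_muStar_eq hS hl hB hα hr m,
    gaussianReal_section_muStar hS hl hB hα hr] at hrq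
  rw [gaussianReal_section_muStar hS hl hB hα hr]
  rw [postLin_eq_inner] at hm
  exact gaussianReal_ge_of_ge hv hm (measurableSet_section _ r hQ)
    (measurableSet_one_sided_test _ (measurableSet_section _ r hB) _) (fun z hz => hz.1)
    (separated_one_sided_test _ _ _) hrq

end Conditional

end Assembly

end PostSel

/-! ### The main theorem -/

theorem proposition1 {ι κ : Type*} [Fintype ι] [DecidableEq ι] [Fintype κ]
    (S : Matrix ι ι ℝ) (hS : S.PosDef)
    (post : κ ↪ ι) (l : κ → ℝ) (hl : l ≠ 0)
    (B : Set (EuclideanSpace ℝ ι)) (hB : MeasurableSet B) (hBpos : 0 < volume B)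
    (α : ℝ) (hα : α ∈ Set.Ioo (0 : ℝ) 1) :
    -- the defining equation of the estimator has almost surely exactly one solution
    (∀ β : EuclideanSpace ℝ ι, ∀ᵐ b ∂(PostSel.condLaw S B β),
      ∃! m : ℝ, PostSel.SolvesAt S post l B α b m) ∧
    -- the estimator belongs to the class
    PostSel.IsQuantileCondUnbiased S post l B α (PostSel.muStar S post l B α) ∧
    -- and it has the smallest conditional expected loss in the class
    ∀ q : EuclideanSpace ℝ ι → ℝ, PostSel.IsQuantileCondUnbiased S post l B α q →
      ∀ (L : ℝ → ℝ → ℝ) (β : EuclideanSpace ℝ ι),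
        QuasiconvexOn ℝ Set.univ (fun d => L d (PostSel.postLin post l β)) →
        (∀ d : ℝ, L (PostSel.postLin post l β) (PostSel.postLin post l β) ≤
          L d (PostSel.postLin post l β)) →
        PostSel.extExpect (PostSel.condLaw S B β)
            (fun b => L (PostSel.muStar S post l B α b) (PostSel.postLin post l β)) ≤
          PostSel.extExpect (PostSel.condLaw S B β)
            (fun b => L (q b) (PostSel.postLin post l β)) := by
  have hpos := fun β => ((PostSel.isGaussianLocation_multivariateGaussian hS).measure_pos
    (PostSel.surjective_toEuclideanCLM hS) hB hBpos β).ne'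
  refine ⟨fun β => ?_, PostSel.isQuantileCondUnbiased_muStar hS hl hB hBpos hα,
    fun q hq L β hL hmin => ?_⟩
  -- The conditional law is a scalar multiple of the restriction to `B`.
  · refine Measure.ae_smul_measure ?_ _
    filter_upwards [PostSel.ae_hasMassOnBothSides (post := post) hS hl hB β] with b hb
    exact (PostSel.existsUnique_solvesAt_and_muStar_spec hS hl hB hα hb).1
  · have : IsProbabilityMeasure (PostSel.condLaw S B β) := cond_isProbabilityMeasure (hpos β)
    refine PostSel.extExpect_le_extExpect_of_concentrated
      (PostSel.measurable_muStar hS hl hB hα) hq.measurable (fun m hm => ?_) (fun m hm => ?_) hL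
      hmin
    · rw [PostSel.condLaw, cond_apply hB, cond_apply hB]
      exact mul_le_mul' le_rfl
        (PostSel.multivariateGaussian_le_muStar_of_le hS hl hB hBpos hα hq hm)
    · rw [PostSel.condLaw, cond_apply hB, cond_apply hB]
      exact mul_le_mul' le_rfl
        (PostSel.multivariateGaussian_muStar_le_of_ge hS hl hB hBpos hα hq hm)
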